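/- There is an algorithm which, given a finite group presentation $(E,R)$ (a finite set $E$ of generators and a finite list $R$ of words over $E\cup E^{-1}$), constructs a finite connected bipartite graph $G$ such that, for every base vertex $a$ of $G$, \[ \pi_1^{\square}(G)[a] \cong \langle E : R\rangle , \] where $\langle E:R\rangle$ is the quotient of the free group $\mathbb F_E$ by the smallest normal subgroup containing $R$. Formally, there is a computable map sending (the number of generators and list of relators of) each such presentation to (the number of vertices and list of edges of) such a graph. Here walks are finite sequences $p_0p_1\cdots p_n$ of successively adjacent vertices; a walk is non-backtracking if $p_i\neq p_{i+2}$ for all $0\le i\le n-2$; $p\star q$ is the concatenation of $p$ and $q$ (the end of $p$ being the start of $q$) in which all factors $aba$ have been successively replaced by $a$; and $p^{-1}$ is the reversed walk. The fundamental group $\pi_1(G)[a]$ is the set of non-backtracking walks from $a$ to $a$ with the product $\star$. A square is a closed non-backtracking walk $s_0s_1s_2s_3s_4$ ($s_4=s_0$) of length four. $\Delta(G)[a]$ is the (normal) subgroup of $\pi_1(G)[a]$ generated by the elements $p\star s\star p^{-1}$, where $s$ is a square and $p$ is a non-backtracking walk from $a$ to $s_0$. The square group is $\pi_1^{\square}(G)[a]=\pi_1(G)[a]/\Delta(G)[a]$;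 for connected $G$ its isomorphism class does not depend on $a$. -/

import Mathlib

namespace GraphSquare

open SimpleGraph

variable {V : Type*} {G : SimpleGraph V}

/-- A walk is non-backtracking when it contains no factor `aba`. -/
def NonBacktracking {u v : V} (p : G.Walk u v) : Prop :=
  ∀ i : ℕ, i + 2 ≤ p.length → p.getVert i ≠ p.getVert (i + 2)

open Classical in
/-- Put one edge in front of a walk, and delete the backtrack if one is created at the front. -/
noncomputable def consReduce {u v w : V} (h : G.Adj u v) (p : G.Walk v w) : G.Walk u w :=
  match p with
  | .nil => .cons h .nil
  | .cons (v := x) h' p' =>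
      if e : x = u then p'.copy e rfl else .cons h (.cons h' p')

/-- Read the edges of `p` from the last one to the first one and put each of them in front of `q`,
deleting every backtrack as soon as it appears. -/
noncomputable def concatReduce {u v w : V} (p : G.Walk u v) (q : G.Walk v w) : G.Walk u w :=
  match p with
  | .nil => q
  | .cons h p' => consReduce h (concatReduce p' q)

/-- The non-backtracking walk obtained from `p` by successively replacing all factors
`aba` by `a`. The order of the replacements is irrelevant, see `reduce_backtrack`. -/
noncomputable def reduce {u v : V} (p : G.Walk u v) : G.Walk u v :=
  concatReduce p .nil

/-- Concatenation of walks followed by the removal of all backtracks. -/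
noncomputable def walkStar {u v w : V} (p : G.Walk u v) (q : G.Walk v w) : G.Walk u w :=
  reduce (p.append q)

theorem nonBacktracking_nil {u : V} : NonBacktracking (Walk.nil : G.Walk u u) := by
  intro i hi
  simp at hi

theorem nonBacktracking_single {u v : V} (h : G.Adj u v) :
    NonBacktracking (Walk.cons h Walk.nil) := by
  intro i hi
  simp at hi

theorem nonBacktracking_cons_cons {u v x w : V} (h : G.Adj u v) (h' : G.Adj v x)
    (p : G.Walk x w) :
    NonBacktracking (Walk.cons h (Walk.cons h' p)) ↔
      u ≠ x ∧ NonBacktracking (Walk.cons h' p) := by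
  constructor
  · intro H
    refine ⟨?_, fun i hi => ?_⟩
    · simpa using H 0 (by simp)
    · simpa using H (i + 1) (by simp at hi ⊢; omega)
  · rintro ⟨H0, H⟩ i hi
    cases i with
    | zero => simpa using H0
    | succ i => simpa using H i (by simp at hi ⊢; omega)

theorem NonBacktracking.of_cons {u v w : V} {h : G.Adj u v} {p : G.Walk v w}
    (H : NonBacktracking (Walk.cons h p)) : NonBacktracking p := by
  cases p with
  | nil => exact nonBacktracking_nil
  | cons h' p' => exact ((nonBacktracking_cons_cons h h' p').1 H).2

theorem NonBacktracking.consReduce {u v w : V} (h : G.Adj u v) {p : G.Walk v w}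
    (H : NonBacktracking p) : NonBacktracking (consReduce h p) := by
  cases p with
  | nil => exact nonBacktracking_single h
  | @cons _ x _ h' p' =>
    by_cases e : x = u
    · subst e
      simpa [GraphSquare.consReduce] using H.of_cons
    · simp only [GraphSquare.consReduce, e, dite_false]
      exact (nonBacktracking_cons_cons h h' p').2 ⟨fun e' => e e'.symm, H⟩

theorem consReduce_of_nonBacktracking {u v w : V} {h : G.Adj u v} {p : G.Walk v w}
    (H : NonBacktracking (Walk.cons h p)) : consReduce h p = Walk.cons h p := by
  cases p with
  | nil => rfl
  | @cons _ x _ h' p' =>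
    have e : ¬ x = u := fun e => ((nonBacktracking_cons_cons h h' p').1 H).1 e.symm
    simp [consReduce, e]

theorem consReduce_symm_cancel {u v w : V} (h : G.Adj u v) (h' : G.Adj v u) {p : G.Walk v w}
    (H : NonBacktracking p) : consReduce h' (consReduce h p) = p := by
  cases p with
  | nil => simp [consReduce]
  | @cons _ x _ h'' p' =>
    by_cases e : x = u
    · subst e
      simpa [consReduce] using consReduce_of_nonBacktracking H
    · simp [consReduce, e]

theorem NonBacktracking.concatReduce {u v w : V} (p : G.Walk u v) {q : G.Walk v w}
    (H : NonBacktracking q) : NonBacktracking (concatReduce p q) := by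
  induction p with
  | nil => exact H
  | cons h p ih => exact (ih H).consReduce h

theorem concatReduce_append {u v w x : V} (p : G.Walk u v) (q : G.Walk v w) (r : G.Walk w x) :
    concatReduce (p.append q) r = concatReduce p (concatReduce q r) := by
  induction p with
  | nil => rfl
  | cons h p ih => simp [concatReduce, ih]

theorem concatReduce_consReduce {u v w x : V} (h : G.Adj u v) (p : G.Walk v w)
    {q : G.Walk w x} (H : NonBacktracking q) :
    concatReduce (consReduce h p) q = consReduce h (concatReduce p q) := by
  cases p with
  | nil => rfl
  | @cons _ y _ h' p' =>
    by_cases e : y = u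
    · subst e
      simp only [consReduce, concatReduce, dite_true, Walk.copy_rfl_rfl]
      exact (consReduce_symm_cancel h' h (H.concatReduce p')).symm
    · simp [consReduce, concatReduce, e]

theorem concatReduce_concatReduce {u v w x : V} (p : G.Walk u v) (q : G.Walk v w)
    {r : G.Walk w x} (H : NonBacktracking r) :
    concatReduce (concatReduce p q) r = concatReduce p (concatReduce q r) := by
  induction p with
  | nil => rfl
  | cons h p ih => simp only [concatReduce]; rw [concatReduce_consReduce _ _ H, ih]

theorem reduce_of_nonBacktracking {u v : V} {p : G.Walk u v} (H : NonBacktracking p) :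
    reduce p = p := by
  induction p with
  | nil => rfl
  | cons h p ih =>
    have e : concatReduce p Walk.nil = p := ih H.of_cons
    simp only [reduce, concatReduce]
    rw [e, consReduce_of_nonBacktracking H]

theorem nonBacktracking_reduce {u v : V} (p : G.Walk u v) : NonBacktracking (reduce p) :=
  nonBacktracking_nil.concatReduce p

theorem reduce_append {u v w : V} (p : G.Walk u v) (q : G.Walk v w) :
    reduce (p.append q) = concatReduce p (reduce q) :=
  concatReduce_append p q _

/-- Removing any one backtrack does not change the reduced walk. -/
theorem reduce_backtrack {u v w x : V} (p : G.Walk u v) (h : G.Adj v w) (h' : G.Adj w v)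
    (q : G.Walk v x) :
    reduce (p.append (Walk.cons h (Walk.cons h' q))) = reduce (p.append q) := by
  rw [reduce_append, reduce_append]
  exact congrArg _ (consReduce_symm_cancel h' h (nonBacktracking_reduce q))

theorem nonBacktracking_star {u v w : V} (p : G.Walk u v) (q : G.Walk v w) :
    NonBacktracking (walkStar p q) :=
  nonBacktracking_reduce _

theorem star_eq_concatReduce {u v w : V} (p : G.Walk u v) {q : G.Walk v w}
    (H : NonBacktracking q) : walkStar p q = concatReduce p q := by
  rw [walkStar, reduce_append, reduce_of_nonBacktracking H]

theorem star_assoc {u v w x : V} (p : G.Walk u v) (q : G.Walk v w) (r : G.Walk w x) :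
    walkStar (walkStar p q) r = walkStar p (walkStar q r) := by
  have h : ∀ {a b c : V} (s : G.Walk a b) (t : G.Walk b c),
      walkStar s t = concatReduce s (reduce t) := fun s t => reduce_append s t
  rw [h (walkStar p q), h p (walkStar q r), reduce_of_nonBacktracking (nonBacktracking_star q r),
    h p q, h q r, concatReduce_concatReduce p _ (nonBacktracking_reduce r)]
  congr 1
  rw [reduce, concatReduce_concatReduce q _ (nonBacktracking_reduce r)]
  rfl

theorem star_nil {u v : V} {p : G.Walk u v} (H : NonBacktracking p) :
    walkStar p Walk.nil = p := by
  rw [walkStar, Walk.append_nil, reduce_of_nonBacktracking H]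

theorem nil_star {u v : V} {p : G.Walk u v} (H : NonBacktracking p) :
    walkStar Walk.nil p = p := by
  rw [walkStar, Walk.nil_append, reduce_of_nonBacktracking H]

theorem concatReduce_reverse {u v w : V} (p : G.Walk u v) {q : G.Walk v w}
    (H : NonBacktracking q) : concatReduce p.reverse (concatReduce p q) = q := by
  induction p with
  | nil => rfl
  | cons h p ih =>
    rw [Walk.reverse_cons, concatReduce_append]
    simp only [concatReduce]
    rw [consReduce_symm_cancel h _ (H.concatReduce p), ih H]

theorem reverse_star {u v : V} (p : G.Walk u v) : walkStar p.reverse p = Walk.nil := by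
  rw [walkStar, reduce_append]
  exact concatReduce_reverse p nonBacktracking_nil

theorem star_reverse {u v : V} (p : G.Walk u v) : walkStar p p.reverse = Walk.nil := by
  simpa using reverse_star p.reverse

theorem NonBacktracking.reverse {u v : V} {p : G.Walk u v} (H : NonBacktracking p) :
    NonBacktracking p.reverse := by
  intro i hi
  rw [Walk.length_reverse] at hi
  rw [Walk.getVert_reverse, Walk.getVert_reverse]
  have := H (p.length - (i + 2)) (by omega)
  rw [show p.length - (i + 2) + 2 = p.length - i by omega] at this
  exact this.symm

theorem reverse_of_star {u v w : V} (p : G.Walk u v) (q : G.Walk v w) :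
    (walkStar p q).reverse = walkStar q.reverse p.reverse := by
  have h1 : walkStar (walkStar p q) (walkStar q.reverse p.reverse) = Walk.nil := by
    rw [star_assoc, ← star_assoc q, star_reverse q, walkStar, reduce_append,
      show walkStar Walk.nil p.reverse = reduce p.reverse from rfl,
      reduce_of_nonBacktracking (nonBacktracking_reduce _), ← reduce_append]
    exact star_reverse p
  have h2 := (nonBacktracking_star p q).reverse
  rw [← star_nil h2, ← h1, ← star_assoc, reverse_star,
    nil_star (nonBacktracking_star q.reverse p.reverse)]

/-- The fundamental group based at `a`: the non-backtracking closed walks from `a` to `a`. -/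
def FundamentalGroup (G : SimpleGraph V) (a : V) : Type _ :=
  {p : G.Walk a a // NonBacktracking p}

/-- The product is `walkStar`, the identity is the walk of length zero, and the inverse of a walk is
its reverse. -/
noncomputable instance instGroup (a : V) : Group (FundamentalGroup G a) where
  mul p q := ⟨walkStar p.1 q.1, nonBacktracking_star _ _⟩
  one := ⟨Walk.nil, nonBacktracking_nil⟩
  inv p := ⟨p.1.reverse, p.2.reverse⟩
  mul_assoc p q r := Subtype.ext (star_assoc p.1 q.1 r.1)
  one_mul p := Subtype.ext (nil_star p.2)
  mul_one p := Subtype.ext (star_nil p.2)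
  inv_mul_cancel p := Subtype.ext (reverse_star p.1)

/-- A square is a non-backtracking closed walk of length four. -/
def IsSquareCycle {b : V} (s : G.Walk b b) : Prop :=
  s.length = 4 ∧ NonBacktracking s

/-- The elements `p ⋆ s ⋆ p⁻¹`, with `p` a non-backtracking walk starting at `a` and `s` a square
based at the end of `p`. -/
def squareConjugates (G : SimpleGraph V) (a : V) : Set (FundamentalGroup G a) :=
  {c | ∃ (b : V) (p : G.Walk a b) (s : G.Walk b b), NonBacktracking p ∧ IsSquareCycle s ∧
    c.1 = walkStar (walkStar p s) p.reverse}

/-- The subgroup of square-decomposable cycles. -/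
noncomputable def squareSubgroup (G : SimpleGraph V) (a : V) : Subgroup (FundamentalGroup G a) :=
  Subgroup.closure (squareConjugates G a)

theorem conj_mem_squareConjugates {a : V} {c : FundamentalGroup G a}
    (hc : c ∈ squareConjugates G a) (g : FundamentalGroup G a) :
    g * c * g⁻¹ ∈ squareConjugates G a := by
  obtain ⟨b, p, s, -, hs, e⟩ := hc
  refine ⟨b, walkStar g.1 p, s, nonBacktracking_star _ _, hs, ?_⟩
  change walkStar (walkStar g.1 c.1) g.1.reverse = _
  rw [e, reverse_of_star]
  simp only [star_assoc]

instance instNormal (a : V) : (squareSubgroup G a).Normal where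
  conj_mem x hx g := by
    induction hx using Subgroup.closure_induction with
    | mem x hx => exact Subgroup.subset_closure (conj_mem_squareConjugates hx g)
    | one => simp [one_mem]
    | mul x y _ _ ihx ihy =>
      have := mul_mem ihx ihy
      rwa [show g * x * g⁻¹ * (g * y * g⁻¹) = g * (x * y) * g⁻¹ by group] at this
    | inv x _ ih =>
      have := inv_mem ih
      rwa [show (g * x * g⁻¹)⁻¹ = g * x⁻¹ * g⁻¹ by group] at this

/-- The square group of `G` based at `a`. -/
abbrev SquareGroup (G : SimpleGraph V) (a : V) : Type _ :=
  FundamentalGroup G a ⧸ squareSubgroup G a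

/-- The group `⟨E : R⟩` of the finite presentation with generators `E = {0, …, n - 1}` and with the
relators `R` given as words, a letter being a generator with an exponent
(`true` for `1`, `false` for `-1`). -/
abbrev GroupOfPresentation (n : ℕ) (R : List (List (Fin n × Bool))) : Type :=
  PresentedGroup {r : FreeGroup (Fin n) | ∃ w ∈ R, FreeGroup.mk w = r}

/-- The finite presentation as an input of an algorithm: the number of generators, and
the list of the relators. -/
def presentationCode (n : ℕ) (R : List (List (Fin n × Bool))) : ℕ × List (List (ℕ × Bool)) :=
  (n, R.map fun w => w.map fun l => (l.1.val, l.2))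

/-- A pair `(m, L)` describes a finite undirected graph with vertex set `{0, …, m - 1}` when `L` lists
its edges, each as an ordered pair of vertices and in both directions. -/
def Describes (c : ℕ × List (ℕ × ℕ)) (G : SimpleGraph (Fin c.1)) : Prop :=
  ∀ e : ℕ × ℕ, e ∈ c.2 ↔ ∃ u v : Fin c.1, G.Adj u v ∧ e = (u.val, v.val)

end GraphSquare

namespace GraphSquare

open SimpleGraph

/-! The graph is the incidence graph of points and blocks. A square in it consists of two points
lying in two common blocks, so killing the squares says that the step between two points is the same
through every block containing both. Each block then acts as a full simplex on its points, glued to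
the other blocks along common points and edges, and it remains to build the presentation complex
from such simplices.

A generator `i` is a triangle through the points `0`, `3 * i + 1`, `3 * i + 2`. The closed walk p_0,
p_1, ... of a relator may revisit points, so a single block on its points would impose unwanted
relations. Instead a parallel ring of distinct points q_0, q_1, ... is introduced; overlapping
blocks {p_t, p_(t+1), q_t, q_(t+1)} form an annulus, one more closes it, and a block containing the
whole ring is the disc.

Every block `b` brings one new point `b + 1` and hangs from a point of number at most `b`. This
gives a spanning tree; numbers without a role only produce pendant pieces.

By `nonempty_squareGroup_mulEquiv` it suffices to know the voltages that are trivial on the tree.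
Generator values satisfying the relators define one (`exists_potential`, `incidenceValue_mul_inv`).
Conversely, any such voltage forces the relators (`apply_close`) and is determined by its values on
the generators (`apply_eq_incidenceValue`). Computability is immediate, since the edges are listed
by explicit arithmetic. -/

/-- A voltage assignment: opposite darts carry inverse values, and the value of each closed walk
of length four is trivial. -/
structure IsVoltage {V H : Type*} [Group H] (G : SimpleGraph V) (g : V → V → H) : Prop where
  symm : ∀ {u v}, G.Adj u v → g u v * g v u = 1
  square : ∀ {s₀ s₁ s₂ s₃}, G.Adj s₀ s₁ → G.Adj s₁ s₂ → G.Adj s₂ s₃ → G.Adj s₃ s₀ →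
    g s₀ s₁ * g s₁ s₂ * g s₂ s₃ * g s₃ s₀ = 1

/-! ### Voltages as homomorphisms on the square group -/

section WalkValue

variable {V H : Type*} [Group H] {G : SimpleGraph V}

/-- The product of the values of the darts of a walk. -/
def walkValue (g : V → V → H) {u v : V} (p : G.Walk u v) : H :=
  match p with
  | .nil => 1
  | .cons (u := a) (v := b) _ p' => g a b * walkValue g p'

theorem walkValue_append (g : V → V → H) {u v w : V} (p : G.Walk u v) (q : G.Walk v w) :
    walkValue g (p.append q) = walkValue g p * walkValue g q := by
  induction p with
  | nil => simp [walkValue]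
  | cons h p ih => simp [walkValue, ih, mul_assoc]

theorem walkValue_reverse {g : V → V → H} (hg : IsVoltage G g) {u v : V} (p : G.Walk u v) :
    walkValue g p.reverse = (walkValue g p)⁻¹ := by
  induction p with
  | nil => simp [walkValue]
  | cons h p ih =>
    rw [Walk.reverse_cons, walkValue_append, ih]
    simp [walkValue, eq_inv_of_mul_eq_one_right (hg.symm h)]

theorem walkValue_consReduce {g : V → V → H} (hg : IsVoltage G g) {u v w : V} (h : G.Adj u v)
    (p : G.Walk v w) : walkValue g (consReduce h p) = g u v * walkValue g p := by
  cases p with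
  | nil => rfl
  | @cons _ x _ h' p' =>
    by_cases e : x = u
    · subst e
      simp [consReduce, walkValue, ← mul_assoc, hg.symm h]
    · simp [consReduce, walkValue, e]

theorem walkValue_concatReduce {g : V → V → H} (hg : IsVoltage G g) {u v w : V}
    (p : G.Walk u v) (q : G.Walk v w) :
    walkValue g (concatReduce p q) = walkValue g p * walkValue g q := by
  induction p with
  | nil => simp [walkValue, concatReduce]
  | cons h p ih => simp [walkValue, concatReduce, walkValue_consReduce hg, ih, mul_assoc]

theorem walkValue_reduce {g : V → V → H} (hg : IsVoltage G g) {u v : V} (p : G.Walk u v) :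
    walkValue g (reduce p) = walkValue g p := by
  simp [reduce, walkValue_concatReduce hg, walkValue]

theorem walkValue_star {g : V → V → H} (hg : IsVoltage G g) {u v w : V} (p : G.Walk u v)
    (q : G.Walk v w) : walkValue g (walkStar p q) = walkValue g p * walkValue g q := by
  rw [walkStar, walkValue_reduce hg, walkValue_append]

theorem walkValue_of_length_four {g : V → V → H} (hg : IsVoltage G g) {b : V} (s : G.Walk b b)
    (hs : s.length = 4) : walkValue g s = 1 := by
  match s, hs with
  | .cons h₀ (.cons h₁ (.cons h₂ (.cons h₃ .nil))), _ =>
    simpa [walkValue, mul_assoc] using hg.square h₀ h₁ h₂ h₃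

/-- The homomorphism from the fundamental group defined by a voltage assignment. -/
noncomputable def fundamentalValue {g : V → V → H} (hg : IsVoltage G g) (a : V) :
    FundamentalGroup G a →* H where
  toFun p := walkValue g p.1
  map_one' := rfl
  map_mul' p q := walkValue_star hg p.1 q.1

/-- The homomorphism from the square group defined by a voltage assignment. -/
noncomputable def squareValue {g : V → V → H} (hg : IsVoltage G g) (a : V) :
    SquareGroup G a →* H :=
  QuotientGroup.lift (squareSubgroup G a) (fundamentalValue hg a) <| by
    rw [squareSubgroup, Subgroup.closure_le]
    rintro c ⟨b, p, s, -, hs, e⟩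
    change walkValue g c.1 = 1
    rw [e, walkValue_star hg, walkValue_star hg, walkValue_of_length_four hg s hs.1,
      walkValue_reverse hg]
    simp

end WalkValue

/-! ### The tautological voltage with values in the square group -/

section SquareClass

variable {V : Type*} {G : SimpleGraph V} {a : V}

/-- The element of the square group represented by a closed walk. -/
noncomputable def squareClass (p : G.Walk a a) : SquareGroup G a :=
  QuotientGroup.mk ⟨reduce p, nonBacktracking_reduce p⟩

theorem squareValue_squareClass {H : Type*} [Group H] {g : V → V → H} (hg : IsVoltage G g)
    (p : G.Walk a a) : squareValue hg a (squareClass p) = walkValue g p :=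
  walkValue_reduce hg p

theorem exists_squareClass (c : SquareGroup G a) : ∃ p : G.Walk a a, squareClass p = c := by
  obtain ⟨p, rfl⟩ := QuotientGroup.mk_surjective c
  exact ⟨p.1, congrArg _ (Subtype.ext (reduce_of_nonBacktracking p.2))⟩

theorem squareClass_congr {p q : G.Walk a a} (h : reduce p = reduce q) :
    squareClass p = squareClass q :=
  congrArg (QuotientGroup.mk : FundamentalGroup G a → _) (Subtype.ext h)

theorem reduce_append_congr {u v w : V} {p p' : G.Walk u v} {q q' : G.Walk v w}
    (hp : reduce p = reduce p') (hq : reduce q = reduce q') :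
    reduce (p.append q) = reduce (p'.append q') := by
  have key : ∀ r : G.Walk u v, reduce (r.append q) = concatReduce (reduce r) (reduce q) := by
    intro r
    exact (reduce_append r q).trans
      (concatReduce_concatReduce r Walk.nil (nonBacktracking_reduce q)).symm
  rw [key, hp, ← key, reduce_append, reduce_append, hq]

theorem reduce_reduce {u v : V} (p : G.Walk u v) : reduce (reduce p) = reduce p :=
  reduce_of_nonBacktracking (nonBacktracking_reduce p)

theorem squareClass_mul (p q : G.Walk a a) :
    squareClass p * squareClass q = squareClass (p.append q) := by
  change (QuotientGroup.mk (_ * _) : SquareGroup G a) = _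
  refine congrArg _ (Subtype.ext ?_)
  exact reduce_append_congr (reduce_reduce p) (reduce_reduce q)

/-- The middle part `r.reverse`, `r` disappears by successive backtracks; this makes products of
voltages telescope. -/
theorem squareClass_mul_cancel {u : V} (p : G.Walk a u) (r : G.Walk a u) (q : G.Walk u a) :
    squareClass (p.append r.reverse) * squareClass (r.append q) = squareClass (p.append q) := by
  rw [squareClass_mul]
  refine squareClass_congr ?_
  rw [← Walk.append_assoc]
  refine reduce_append_congr rfl ?_
  rw [reduce_append, reduce_append, concatReduce_reverse r (nonBacktracking_reduce q)]

theorem squareClass_append_reverse {u : V} (p : G.Walk a u) :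
    squareClass (p.append p.reverse) = 1 :=
  congrArg _ (Subtype.ext (star_reverse p))

theorem squareClass_square {b : V} (p : G.Walk a b) {s : G.Walk b b} (hs : IsSquareCycle s) :
    squareClass (p.append (s.append p.reverse)) = 1 := by
  refine (QuotientGroup.eq_one_iff _).2 (Subgroup.subset_closure ?_)
  refine ⟨b, reduce p, s, nonBacktracking_reduce p, hs, ?_⟩
  change reduce _ = reduce _
  rw [Walk.append_assoc]
  refine reduce_append_congr ?_ ?_
  · change _ = reduce (reduce _)
    rw [reduce_reduce]
    exact reduce_append_congr (reduce_reduce p).symm rfl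
  · have h := reverse_of_star p (Walk.nil : G.Walk b b)
    simp only [walkStar, Walk.append_nil, Walk.reverse_nil, Walk.nil_append] at h
    rw [h, reduce_reduce]

open Classical in
/-- The voltage assignment with values in the square group given by a choice of walks from the
base vertex. -/
noncomputable def classVoltage (W : ∀ v, G.Walk a v) (u v : V) : SquareGroup G a :=
  if h : G.Adj u v then squareClass ((W u).append (.cons h (W v).reverse)) else 1

/-- The product telescopes: the return along `W` after each edge cancels the departure along `W`
before the next. -/
theorem walkValue_classVoltage (W : ∀ v, G.Walk a v) {u v : V} (p : G.Walk u v) :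
    walkValue (classVoltage W) p = squareClass ((W u).append (p.append (W v).reverse)) := by
  induction p with
  | nil => simp [walkValue, squareClass_append_reverse]
  | @cons u w v h p ih =>
    simp only [walkValue, ih, classVoltage, h, dite_true]
    rw [← Walk.nil_append (W w).reverse, ← Walk.cons_append, Walk.append_assoc,
      squareClass_mul_cancel, ← Walk.append_assoc, Walk.cons_append, Walk.nil_append,
      Walk.cons_append]

theorem isVoltage_classVoltage (W : ∀ v, G.Walk a v) : IsVoltage G (classVoltage W) := by
  have hsymm : ∀ {u v}, G.Adj u v → classVoltage W u v * classVoltage W v u = 1 := by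
    intro u v h
    have := walkValue_classVoltage W (.cons h (.cons h.symm .nil))
    simp only [walkValue, mul_one] at this
    rw [this, ← squareClass_append_reverse (W u)]
    exact squareClass_congr (reduce_backtrack (W u) h h.symm _)
  refine ⟨hsymm, ?_⟩
  intro s₀ s₁ s₂ s₃ h₀ h₁ h₂ h₃
  -- `IsVoltage` covers all closed walks of length four; the backtracking ones are not squares and
  -- follow from inverse pairs.
  by_cases e₀ : s₀ = s₂
  · subst e₀
    rw [hsymm h₀, one_mul, hsymm h₂]
  by_cases e₁ : s₁ = s₃
  · subst e₁
    rw [mul_assoc (classVoltage W s₀ s₁), hsymm h₁, mul_one, hsymm h₀]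
  have := walkValue_classVoltage W (.cons h₀ (.cons h₁ (.cons h₂ (.cons h₃ .nil))))
  rw [squareClass_square] at this
  · simpa [walkValue, mul_assoc] using this
  · refine ⟨rfl, ?_⟩
    rw [nonBacktracking_cons_cons, nonBacktracking_cons_cons, nonBacktracking_cons_cons]
    exact ⟨e₀, e₁, Ne.symm e₀, nonBacktracking_single _⟩

end SquareClass

/-! ### Spanning trees and the universal voltage -/

section Tree

variable {V : Type*} {G : SimpleGraph V} {o : V} {T : V → V}

/-- The walk from the root along a rooted spanning tree given by its parent function. -/
noncomputable def treeWalk (rank : V → ℕ)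
    (hT : ∀ v, v ≠ o → G.Adj (T v) v ∧ rank (T v) < rank v) (v : V) : G.Walk o v :=
  open Classical in
  if h : v = o then Walk.nil.copy rfl h.symm
  else (treeWalk rank hT (T v)).append (.cons (hT v h).1 .nil)
termination_by rank v
decreasing_by exact (hT v h).2

theorem treeWalk_of_ne (rank : V → ℕ)
    (hT : ∀ v, v ≠ o → G.Adj (T v) v ∧ rank (T v) < rank v) {v : V} (h : v ≠ o) :
    treeWalk rank hT v = (treeWalk rank hT (T v)).append (.cons (hT v h).1 .nil) := by
  rw [treeWalk, dif_neg h]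

theorem walkValue_treeWalk {H : Type*} [Group H] {g : V → V → H} (rank : V → ℕ)
    (hT : ∀ v, v ≠ o → G.Adj (T v) v ∧ rank (T v) < rank v)
    (hg : ∀ v, v ≠ o → g (T v) v = 1) (v : V) : walkValue g (treeWalk rank hT v) = 1 := by
  induction hk : rank v using Nat.strong_induction_on generalizing v with
  | _ k ih =>
    by_cases h : v = o
    · subst h
      rw [treeWalk, dif_pos rfl]
      rfl
    · rw [treeWalk_of_ne rank hT h, walkValue_append, ih _ (hk ▸ (hT v h).2) _ rfl]
      simp [walkValue, hg v h]

theorem connected_of_parent (rank : V → ℕ)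
    (hT : ∀ v, v ≠ o → G.Adj (T v) v ∧ rank (T v) < rank v) : G.Connected where
  preconnected u v := ⟨(treeWalk rank hT u).reverse.append (treeWalk rank hT v)⟩
  nonempty := ⟨o⟩

/-- If a voltage assignment with values in `P` is initial among the voltage assignments that are
trivial on a spanning tree, then the square group is isomorphic to `P`. -/
theorem nonempty_squareGroup_mulEquiv {V P : Type} [Group P] {G : SimpleGraph V} {o : V}
    {T : V → V} (rank : V → ℕ)
    (hT : ∀ v, v ≠ o → G.Adj (T v) v ∧ rank (T v) < rank v) {l : V → V → P}
    (hl : IsVoltage G l) (hlT : ∀ v, v ≠ o → l (T v) v = 1)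
    (hgen : Subgroup.closure {x | ∃ u v, G.Adj u v ∧ l u v = x} = ⊤)
    -- The only target used is the square group of `G`, which lies in `Type`.
    (hinit : ∀ (S : Type) [Group S] (g : V → V → S), IsVoltage G g →
      (∀ v, v ≠ o → g (T v) v = 1) → ∃ ψ : P →* S, ∀ u v, G.Adj u v → ψ (l u v) = g u v)
    (a : V) : Nonempty (SquareGroup G a ≃* P) := by
  -- Passing through the root makes `W (T v)` followed by the tree edge literally `W v`, so tree
  -- edges get class 1. The price is that `W a` only reduces to the trivial walk.
  let W : ∀ v, G.Walk a v := fun v => (treeWalk rank hT a).reverse.append (treeWalk rank hT v)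
  have hW : ∀ v, walkValue l (W v) = 1 := fun v => by
    rw [walkValue_append, walkValue_reverse hl, walkValue_treeWalk rank hT hlT,
      walkValue_treeWalk rank hT hlT, inv_one, one_mul]
  have hWT : ∀ v, v ≠ o → classVoltage W (T v) v = 1 := by
    intro v hv
    rw [classVoltage, dif_pos (hT v hv).1, ← squareClass_append_reverse (W v)]
    congr 1
    rw [← Walk.nil_append (W v).reverse, ← Walk.cons_append, Walk.append_assoc]
    congr 1
    simp only [W]
    rw [← Walk.append_assoc, ← treeWalk_of_ne rank hT hv]
  obtain ⟨ψ, hψ⟩ := hinit _ _ (isVoltage_classVoltage W) hWT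
  have hψw : ∀ {u v} (p : G.Walk u v),
      ψ (walkValue l p) = walkValue (classVoltage W) p := by
    intro u v p
    induction p with
    | nil => simp [walkValue]
    | cons h p ih => simp [walkValue, ih, hψ _ _ h]
  have hWa : reduce (W a) = Walk.nil := reverse_star _
  refine ⟨MonoidHom.toMulEquiv (squareValue hl a) ψ ?_ ?_⟩
  · refine MonoidHom.ext fun c => ?_
    obtain ⟨p, rfl⟩ := exists_squareClass c
    simp only [MonoidHom.comp_apply, squareValue_squareClass, hψw, walkValue_classVoltage,
      MonoidHom.id_apply]
    refine squareClass_congr ?_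
    have h1 : reduce (W a) = reduce Walk.nil := hWa
    have h2 : reduce (W a).reverse = reduce Walk.nil := by
      have h := reverse_of_star (W a) (Walk.nil : G.Walk a a)
      simp only [walkStar, Walk.append_nil, Walk.reverse_nil, Walk.nil_append, hWa] at h
      exact h.symm
    rw [reduce_append_congr h1 (reduce_append_congr rfl h2), Walk.nil_append, Walk.append_nil]
  · refine MonoidHom.eq_of_eqOn_dense hgen ?_
    rintro _ ⟨u, v, h, rfl⟩
    simp only [MonoidHom.comp_apply, MonoidHom.id_apply, hψ u v h, classVoltage, h, dite_true,
      squareValue_squareClass, walkValue_append, walkValue, walkValue_reverse hl, hW]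
    simp

end Tree

/-! ### The points and blocks of a presentation -/

/-- The `r`-th relator. -/
def relator (R : List (List (ℕ × Bool))) (r : ℕ) : List (ℕ × Bool) :=
  R[r]?.getD []

/-- The closed walk of a word in the triangulated rose, in which the `i`-th petal has the
vertices `0`, `3 * i + 1` and `3 * i + 2`. -/
def loopPoint (w : List (ℕ × Bool)) (t : ℕ) : ℕ :=
  (w[t / 3]?.map fun l => if t % 3 = 0 then 0 else
    -- A positive letter visits `3 * i + 1` and then `3 * i + 2`, a negative one the reverse. Beyond
    -- the word the default 0 returns the walk to its base.
    if l.2 = decide (t % 3 = 1) then 3 * l.1 + 1 else 3 * l.1 + 2).getD 0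

/-- The point through which a block is attached to the points of smaller number. -/
def parentPoint (n : ℕ) (R : List (List (ℕ × Bool))) (b : ℕ) : ℕ :=
  if b < 3 * n then (if b % 3 = 0 then 0 else b)
  else if (b - 3 * n) % 2 = 0 then
    loopPoint (relator R ((b - 3 * n) / 2).unpair.1) ((b - 3 * n) / 2).unpair.2
  else b

/-- The number of blocks; the number of points is larger by one. -/
def numBlocks (n : ℕ) (R : List (List (ℕ × Bool))) : ℕ :=
  3 * n + 2 * (R.length + 3 * R.flatten.length + 1) ^ 2

/-- Incidence of points and blocks. The blocks below `3 * n` are the edges of the rose, the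
points `3 * n + 2 * Nat.pair r t + 1` form a ring parallel to the closed walk of the `r`-th relator,
the blocks `3 * n + 2 * Nat.pair r t` join the ring to the rose, and the block
`3 * n + 2 * Nat.pair r 0 + 1` fills the ring. -/
inductive Incident (n : ℕ) (R : List (List (ℕ × Bool))) : ℕ → ℕ → Prop
  | child (b : ℕ) (hb : b < numBlocks n R) : Incident n R (b + 1) b
  | parent (b : ℕ) (hb : b < numBlocks n R) : Incident n R (parentPoint n R b) b
  | base (i : ℕ) (hi : i < n) : Incident n R 0 (3 * i + 2)
  | ring (r t : ℕ) (hr : r < R.length) (ht : t < 3 * (relator R r).length) :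
      Incident n R (3 * n + 2 * Nat.pair r (t + 1) + 1) (3 * n + 2 * Nat.pair r t)
  | loop (r t : ℕ) (hr : r < R.length) (ht : t < 3 * (relator R r).length) :
      Incident n R (loopPoint (relator R r) (t + 1)) (3 * n + 2 * Nat.pair r t)
  | disc (r t : ℕ) (hr : r < R.length) (ht : t ≤ 3 * (relator R r).length) :
      Incident n R (3 * n + 2 * Nat.pair r t + 1) (3 * n + 2 * Nat.pair r 0 + 1)
  | close (r : ℕ) (hr : r < R.length) :
      Incident n R (3 * n + 2 * Nat.pair r 0 + 1)
        (3 * n + 2 * Nat.pair r (3 * (relator R r).length))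

section Points

variable {n : ℕ} {R : List (List (ℕ × Bool))}

theorem relator_mem {r : ℕ} (hr : r < R.length) : relator R r ∈ R := by
  simp [relator, hr]

theorem relator_getElem? {r t : ℕ} {l : ℕ × Bool} (h : (relator R r)[t]? = some l) :
    ∃ w ∈ R, l ∈ w := by
  by_cases hr : r < R.length
  · exact ⟨_, relator_mem hr, List.mem_of_getElem? h⟩
  · simp [relator, hr] at h

theorem loopPoint_of_mod {w : List (ℕ × Bool)} {t : ℕ} (ht : t % 3 = 0) : loopPoint w t = 0 := by
  unfold loopPoint
  cases w[t / 3]? <;> simp [ht]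

theorem loopPoint_le (hR : ∀ w ∈ R, ∀ l ∈ w, l.1 < n) (r t : ℕ) :
    loopPoint (relator R r) t ≤ 3 * n := by
  unfold loopPoint
  rcases h : (relator R r)[t / 3]? with _ | l
  · simp
  · obtain ⟨w, hw, hl⟩ := relator_getElem? h
    have := hR w hw l hl
    simp only [Option.map_some, Option.getD_some]
    split_ifs <;> omega

@[simp] theorem parentPoint_ring (r t : ℕ) :
    parentPoint n R (3 * n + 2 * Nat.pair r t) = loopPoint (relator R r) t := by
  simp [parentPoint]

@[simp] theorem parentPoint_disc (c : ℕ) :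
    parentPoint n R (3 * n + 2 * c + 1) = 3 * n + 2 * c + 1 := by
  rw [parentPoint, if_neg (by omega), if_neg (by omega)]

theorem exists_ring_or_disc {b : ℕ} (hb : ¬ b < 3 * n) :
    ∃ r t, b = 3 * n + 2 * Nat.pair r t ∨ b = 3 * n + 2 * Nat.pair r t + 1 := by
  refine ⟨((b - 3 * n) / 2).unpair.1, ((b - 3 * n) / 2).unpair.2, ?_⟩
  rw [Nat.pair_unpair]
  omega

/-- Together with the child `b + 1`, this makes vertex numbers decrease towards the root. -/
theorem parentPoint_le (hR : ∀ w ∈ R, ∀ l ∈ w, l.1 < n) (b : ℕ) : parentPoint n R b ≤ b := by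
  by_cases hb : b < 3 * n
  · rw [parentPoint, if_pos hb]
    split_ifs <;> omega
  · obtain ⟨r, t, rfl | rfl⟩ := exists_ring_or_disc hb
    · rw [parentPoint_ring]
      exact (loopPoint_le hR r t).trans (by omega)
    · rw [parentPoint_disc]

/-- The square in `numBlocks` comes from the bound `Nat.pair r t < (max r t + 1) ^ 2`, with `r` and
`t` estimated by the number and total length of the relators. -/
theorem disc_lt_numBlocks {r t : ℕ} (hr : r < R.length) (ht : t ≤ 3 * (relator R r).length) :
    3 * n + 2 * Nat.pair r t + 1 < numBlocks n R := by
  have h1 : (relator R r).length ≤ R.flatten.length :=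
    (List.sublist_flatten_of_mem (relator_mem hr)).length_le
  have h2 : Nat.pair r t + 1 ≤ (R.length + 3 * R.flatten.length + 1) ^ 2 :=
    (Nat.pair_lt_max_add_one_sq r t).trans_le (Nat.pow_le_pow_left (by omega) 2)
  unfold numBlocks
  omega

theorem base_lt_numBlocks {b : ℕ} (hb : b < 3 * n) : b < numBlocks n R := by
  unfold numBlocks
  omega

theorem Incident.block_lt {a b : ℕ} (h : Incident n R a b) : b < numBlocks n R := by
  cases h with
  | child b hb => exact hb
  | parent b hb => exact hb
  | base i hi => exact base_lt_numBlocks (by omega)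
  | ring r t hr ht => exact (Nat.lt_succ_self _).trans (disc_lt_numBlocks hr ht.le)
  | loop r t hr ht => exact (Nat.lt_succ_self _).trans (disc_lt_numBlocks hr ht.le)
  | disc r t hr ht => exact disc_lt_numBlocks hr (Nat.zero_le _)
  | close r hr => exact (Nat.lt_succ_self _).trans (disc_lt_numBlocks hr le_rfl)

theorem Incident.point_le (hR : ∀ w ∈ R, ∀ l ∈ w, l.1 < n) {a b : ℕ} (h : Incident n R a b) :
    a ≤ numBlocks n R := by
  cases h with
  | child b hb => exact hb
  | parent b hb => exact (parentPoint_le hR b).trans hb.le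
  | base i hi => exact Nat.zero_le _
  | ring r t hr ht => exact (disc_lt_numBlocks hr ht).le
  | loop r t hr ht =>
    exact (loopPoint_le hR r _).trans (by unfold numBlocks; omega)
  | disc r t hr ht => exact (disc_lt_numBlocks hr ht).le
  | close r hr => exact (disc_lt_numBlocks hr (Nat.zero_le _)).le

/-- In this and the next two lemmas the kinds of block are told apart by size and parity, and blocks
of one kind by injectivity of `Nat.pair`. -/
theorem Incident.of_base {a b : ℕ} (hb : b < 3 * n) (h : Incident n R a b) :
    a = b + 1 ∨ a = parentPoint n R b ∨ b % 3 = 2 ∧ a = 0 := by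
  cases h with
  | child => simp
  | parent => simp
  | base i hi => right; right; omega
  | _ => omega

theorem Incident.of_ring {a r t : ℕ} (h : Incident n R a (3 * n + 2 * Nat.pair r t)) :
    a = 3 * n + 2 * Nat.pair r t + 1 ∨ a = loopPoint (relator R r) t ∨
      (r < R.length ∧ t < 3 * (relator R r).length ∧
        (a = 3 * n + 2 * Nat.pair r (t + 1) + 1 ∨ a = loopPoint (relator R r) (t + 1))) ∨
      r < R.length ∧ t = 3 * (relator R r).length ∧ a = 3 * n + 2 * Nat.pair r 0 + 1 := by
  generalize hb : 3 * n + 2 * Nat.pair r t = b at h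
  cases h with
  | child => simp
  | parent => subst hb; simp
  | base i hi => omega
  | ring r' t' hr ht =>
    obtain ⟨rfl, rfl⟩ := Nat.pair_eq_pair.1 (show Nat.pair r t = Nat.pair r' t' by omega)
    simp [hr, ht]
  | loop r' t' hr ht =>
    obtain ⟨rfl, rfl⟩ := Nat.pair_eq_pair.1 (show Nat.pair r t = Nat.pair r' t' by omega)
    simp [hr, ht]
  | disc r' t' hr ht => omega
  | close r' hr =>
    obtain ⟨rfl, rfl⟩ := Nat.pair_eq_pair.1
      (show Nat.pair r t = Nat.pair r' (3 * (relator R r').length) by omega)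
    simp [hr]

theorem Incident.of_disc {a r t : ℕ} (h : Incident n R a (3 * n + 2 * Nat.pair r t + 1)) :
    a = 3 * n + 2 * Nat.pair r t + 2 ∨ a = 3 * n + 2 * Nat.pair r t + 1 ∨
      ∃ s, a = 3 * n + 2 * Nat.pair r s + 1 := by
  generalize hb : 3 * n + 2 * Nat.pair r t + 1 = b at h
  cases h with
  | child => left; omega
  | parent => subst hb; simp
  | disc r' t' hr ht =>
    obtain ⟨rfl, rfl⟩ := Nat.pair_eq_pair.1 (show Nat.pair r t = Nat.pair r' 0 by omega)
    exact Or.inr (Or.inr ⟨t', rfl⟩)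
  | _ => omega

/-- The oriented edges of the rose. -/
def RoseEdge (n u v : ℕ) : Prop :=
  ∃ i < n, u = 0 ∧ v = 3 * i + 1 ∨ u = 3 * i + 1 ∧ v = 3 * i + 2 ∨ u = 3 * i + 2 ∧ v = 0

theorem roseEdge_loopPoint {w : List (ℕ × Bool)} (hw : ∀ l ∈ w, l.1 < n) {t : ℕ}
    (ht : t < 3 * w.length) :
    RoseEdge n (loopPoint w t) (loopPoint w (t + 1)) ∨
      RoseEdge n (loopPoint w (t + 1)) (loopPoint w t) := by
  have hj : t / 3 < w.length := by omega
  have hi := hw _ (List.getElem_mem hj)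
  have h0 : w[t / 3]? = some w[t / 3] := List.getElem?_eq_getElem hj
  generalize w[t / 3] = l at h0 hi
  obtain ⟨i, s⟩ := l
  have hc : t % 3 = 0 ∨ t % 3 = 1 ∨ t % 3 = 2 := by omega
  rcases hc with hc | hc | hc
  · have e1 : (t + 1) / 3 = t / 3 := by omega
    have e2 : (t + 1) % 3 = 1 := by omega
    cases s
    · exact Or.inr ⟨i, hi, by simp [loopPoint, e1, e2, h0, hc]⟩
    · exact Or.inl ⟨i, hi, by simp [loopPoint, e1, e2, h0, hc]⟩
  · have e1 : (t + 1) / 3 = t / 3 := by omega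
    have e2 : (t + 1) % 3 = 2 := by omega
    cases s
    · exact Or.inr ⟨i, hi, by simp [loopPoint, e1, e2, h0, hc]⟩
    · exact Or.inl ⟨i, hi, by simp [loopPoint, e1, e2, h0, hc]⟩
  · rw [loopPoint_of_mod (t := t + 1) (by omega)]
    cases s
    · exact Or.inr ⟨i, hi, by simp [loopPoint, h0, hc]⟩
    · exact Or.inl ⟨i, hi, by simp [loopPoint, h0, hc]⟩

end Points

/-! ### The voltage defined by values of the generators -/

section Values

variable {H : Type*} [Group H] (x : ℕ → H)

/-- The value of a word under an assignment of values to the generators. -/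
def wordValue (w : List (ℕ × Bool)) : H :=
  (w.map fun l => if l.2 then x l.1 else (x l.1)⁻¹).prod

/-- The value of the step from a point of the rose to the point `0`. -/
def rosePotential (u : ℕ) : H :=
  if u = 0 ∨ u % 3 = 1 then 1 else x ((u - 1) / 3)

/-- The value of a step between two points of the rose. -/
def roseStep (u v : ℕ) : H :=
  if v = 0 then rosePotential x u else if u = 0 then (rosePotential x v)⁻¹ else 1

@[simp] theorem roseStep_self (u : ℕ) : roseStep x u u = 1 := by
  unfold roseStep rosePotential
  split_ifs <;> simp_all

theorem roseStep_inv (u v : ℕ) : (roseStep x u v)⁻¹ = roseStep x v u := by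
  unfold roseStep
  split_ifs <;> simp_all [rosePotential]

/-- Antisymmetric steps on two points always come from a potential. On three points this fails: the
steps around a petal multiply to the generator. -/
theorem roseStep_of_pair {p q u v : ℕ} (hu : u = p ∨ u = q) (hv : v = p ∨ v = q) :
    roseStep x u v = (roseStep x p u)⁻¹ * roseStep x p v := by
  rcases hu with rfl | rfl <;> rcases hv with rfl | rfl <;>
    first | (simp; done) | simp [roseStep_inv]

/-- The value of an initial part of the closed walk of a word. -/
def loopValue (w : List (ℕ × Bool)) : ℕ → H
  | 0 => 1
  | t + 1 => loopValue w t * roseStep x (loopPoint w t) (loopPoint w (t + 1))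

/-- Of the three steps of a letter, only the one between `3 * i + 2` and `0` is nontrivial, and its
direction gives the exponent. -/
theorem loopValue_three_mul (w : List (ℕ × Bool)) {j : ℕ} (hj : j ≤ w.length) :
    loopValue x w (3 * j) = wordValue x (w.take j) := by
  induction j with
  | zero => simp [loopValue, wordValue]
  | succ j ih =>
    have hj' : j < w.length := hj
    have h0 : w[j]? = some w[j] := List.getElem?_eq_getElem hj'
    rw [List.take_succ_eq_append_getElem hj', wordValue, List.map_append, List.prod_append,
      ← wordValue, ← ih hj'.le, show 3 * (j + 1) = 3 * j + 1 + 1 + 1 by ring]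
    generalize w[j] = l at h0
    obtain ⟨i, s⟩ := l
    have p0 : loopPoint w (3 * j) = 0 := loopPoint_of_mod (by omega)
    have p3 : loopPoint w (3 * j + 1 + 1 + 1) = 0 := loopPoint_of_mod (by omega)
    have d1 : (3 * j + 1) / 3 = j := by omega
    have d2 : (3 * j + 1 + 1) / 3 = j := by omega
    have m1 : (3 * j + 1) % 3 = 1 := by omega
    have m2 : (3 * j + 1 + 1) % 3 = 2 := by omega
    have q : (3 * i + 1) / 3 = i := by omega
    have k1 : (3 * i + 1) % 3 = 1 := by omega
    have k2 : (3 * i + 2) % 3 = 2 := by omega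
    have p1 : loopPoint w (3 * j + 1) = if s then 3 * i + 1 else 3 * i + 2 := by
      cases s <;> simp [loopPoint, d1, m1, h0]
    have p2 : loopPoint w (3 * j + 1 + 1) = if s then 3 * i + 2 else 3 * i + 1 := by
      cases s <;> simp [loopPoint, d2, m2, h0]
    simp only [loopValue, p0, p1, p2, p3]
    cases s <;> simp [roseStep, rosePotential, q, k1, k2]

variable (n : ℕ) (R : List (List (ℕ × Bool)))

/-- The position in the ring of a point outside the rose. -/
def ringIndex (a : ℕ) : ℕ × ℕ :=
  ((a - 3 * n - 1) / 2).unpair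

/-- The point of the rose next to a ring point. -/
def ringBase (a : ℕ) : ℕ :=
  loopPoint (relator R (ringIndex n a).1) (ringIndex n a).2

/-- The value of the part of the closed walk before a ring point. -/
def ringValue (a : ℕ) : H :=
  loopValue x (relator R (ringIndex n a).1) (ringIndex n a).2

/-- The value of a step between two points of a block. -/
def pointStep (a a' : ℕ) : H :=
  if a ≤ 3 * n then
    if a' ≤ 3 * n then roseStep x a a' else roseStep x a (ringBase n R a')
  else
    if a' ≤ 3 * n then roseStep x (ringBase n R a) a'
    else (ringValue x n R a)⁻¹ * ringValue x n R a'

/-- The value of the edge from a point to a block. -/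
def incidenceValue (a b : ℕ) : H :=
  pointStep x n R a (parentPoint n R b)

variable {n R}

@[simp] theorem ringIndex_ring (r t : ℕ) :
    ringIndex n (3 * n + 2 * Nat.pair r t + 1) = (r, t) := by
  rw [ringIndex, show (3 * n + 2 * Nat.pair r t + 1 - 3 * n - 1) / 2 = Nat.pair r t by omega,
    Nat.unpair_pair]

@[simp] theorem ringIndex_leaf (r t : ℕ) :
    ringIndex n (3 * n + 2 * Nat.pair r t + 2) = (r, t) := by
  rw [ringIndex, show (3 * n + 2 * Nat.pair r t + 2 - 3 * n - 1) / 2 = Nat.pair r t by omega,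
    Nat.unpair_pair]

theorem pointStep_rose_rose {u v : ℕ} (hu : u ≤ 3 * n) (hv : v ≤ 3 * n) :
    pointStep x n R u v = roseStep x u v := by
  simp [pointStep, hu, hv]

theorem pointStep_ring_rose (r t : ℕ) {v : ℕ} (hv : v ≤ 3 * n) :
    pointStep x n R (3 * n + 2 * Nat.pair r t + 1) v =
      roseStep x (loopPoint (relator R r) t) v := by
  rw [pointStep, if_neg (by omega), if_pos hv, ringBase, ringIndex_ring]

theorem pointStep_of_lt {a a' : ℕ} (ha : 3 * n < a) (ha' : 3 * n < a') :
    pointStep x n R a a' = (ringValue x n R a)⁻¹ * ringValue x n R a' := by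
  rw [pointStep, if_neg (by omega), if_neg (by omega)]

@[simp] theorem pointStep_ring_ring (r t r' t' : ℕ) :
    pointStep x n R (3 * n + 2 * Nat.pair r t + 1) (3 * n + 2 * Nat.pair r' t' + 1) =
      (loopValue x (relator R r) t)⁻¹ * loopValue x (relator R r') t' := by
  rw [pointStep_of_lt x (by omega) (by omega), ringValue, ringValue, ringIndex_ring,
    ringIndex_ring]

@[simp] theorem pointStep_self (a : ℕ) : pointStep x n R a a = 1 := by
  unfold pointStep
  split_ifs <;> simp

theorem incidenceValue_child (hR : ∀ w ∈ R, ∀ l ∈ w, l.1 < n) (b : ℕ) :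
    incidenceValue x n R (b + 1) b = 1 := by
  unfold incidenceValue
  by_cases hb : b < 3 * n
  · have hp : parentPoint n R b = if b % 3 = 0 then 0 else b := by rw [parentPoint, if_pos hb]
    rw [pointStep_rose_rose x (by omega) ((parentPoint_le hR b).trans hb.le), hp]
    split_ifs with h
    · simp [roseStep, rosePotential, show (b + 1) % 3 = 1 by omega]
    · simp [roseStep, show b ≠ 0 by omega]
  · obtain ⟨r, t, rfl | rfl⟩ := exists_ring_or_disc hb
    · rw [parentPoint_ring, pointStep_ring_rose x r t (loopPoint_le hR r t), roseStep_self]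
    · rw [parentPoint_disc, pointStep_of_lt x (by omega) (by omega), ringValue, ringValue,
        ringIndex_ring, ringIndex_leaf, inv_mul_cancel]

theorem incidenceValue_parent (b : ℕ) : incidenceValue x n R (parentPoint n R b) b = 1 :=
  pointStep_self x _

theorem incidenceValue_base {i : ℕ} (hi : i < n) :
    incidenceValue x n R 0 (3 * i + 2) = (x i)⁻¹ := by
  have hp : parentPoint n R (3 * i + 2) = 3 * i + 2 := by
    rw [parentPoint, if_pos (by omega), if_neg (by omega)]
  rw [incidenceValue, hp, pointStep_rose_rose x (by omega) (by omega)]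
  simp [roseStep, rosePotential, show (3 * i + 2) % 3 = 2 by omega,
    show (3 * i + 1) / 3 = i by omega]

/-- On each block, the steps between points are differences of a potential. -/
theorem exists_potential (hR : ∀ w ∈ R, ∀ l ∈ w, l.1 < n) (hx : ∀ w ∈ R, wordValue x w = 1)
    (b : ℕ) : ∃ F : ℕ → H, ∀ a a', Incident n R a b → Incident n R a' b →
      pointStep x n R a a' = (F a)⁻¹ * F a' := by
  by_cases hb : b < 3 * n
  · have hp : parentPoint n R b = if b % 3 = 0 then 0 else b := by rw [parentPoint, if_pos hb]
    have hle : ∀ a, Incident n R a b → a ≤ 3 * n := by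
      intro a h
      have := parentPoint_le hR b
      have := h.of_base hb
      omega
    refine ⟨fun a => roseStep x (parentPoint n R b) a, fun a a' h h' => ?_⟩
    rw [pointStep_rose_rose x (hle a h) (hle a' h')]
    by_cases hm : b % 3 = 2
    · have h1 := h.of_base hb
      have h2 := h'.of_base hb
      rw [hp, if_neg (by omega)] at h1 h2 ⊢
      have hb0 : b ≠ 0 := by omega
      -- The pendant child `3 * i + 3` has the same potential as `3 * i + 2`, so this three-point
      -- block causes no obstruction.
      have e : (b - 1) / 3 = b / 3 := by omega
      have e' : (b + 1) % 3 ≠ 1 := by omega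
      rcases h1 with rfl | rfl | ⟨-, rfl⟩ <;> rcases h2 with rfl | rfl | ⟨-, rfl⟩ <;>
        simp [roseStep, rosePotential, hb0, hm, e, e']
    · refine roseStep_of_pair x (q := b + 1) ?_ ?_
      · have := h.of_base hb
        tauto
      · have := h'.of_base hb
        tauto
  · obtain ⟨r, t, rfl | rfl⟩ := exists_ring_or_disc hb
    -- Projection of the annulus onto the rose: a ring block projects into {p_t, p_(t+1)}.
    · let k : ℕ → ℕ := fun a => if a ≤ 3 * n then a else ringBase n R a
      have hk : ∀ {a}, a ≤ 3 * n → k a = a := fun h => if_pos h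
      have hk' : ∀ s, k (3 * n + 2 * Nat.pair r s + 1) = loopPoint (relator R r) s := by
        intro s
        simp only [k]
        rw [if_neg (by omega), ringBase, ringIndex_ring]
      have hv : ∀ s, ringValue x n R (3 * n + 2 * Nat.pair r s + 1) =
          loopValue x (relator R r) s := by
        intro s
        rw [ringValue, ringIndex_ring]
      have key : ∀ a, Incident n R a (3 * n + 2 * Nat.pair r t) →
          (k a = loopPoint (relator R r) t ∨ k a = loopPoint (relator R r) (t + 1)) ∧
          (3 * n < a → ringValue x n R a =
            loopValue x (relator R r) t * roseStep x (loopPoint (relator R r) t) (k a)) := by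
        intro a h
        have l1 := loopPoint_le hR r t
        have l2 := loopPoint_le hR r (t + 1)
        obtain rfl | rfl | ⟨hr, ht, rfl | rfl⟩ | ⟨hr, rfl, rfl⟩ := h.of_ring
        · simp [hk', hv]
        · exact ⟨Or.inl (hk l1), fun h => absurd h (not_lt.2 l1)⟩
        · rw [hk', hv]
          exact ⟨Or.inr rfl, fun _ => rfl⟩
        · exact ⟨Or.inr (hk l2), fun h => absurd h (not_lt.2 l2)⟩
        -- The closing block contains both the first and the last ring point. Their ring values
        -- agree only because the relator has value 1.
        · rw [hk', hv, loopPoint_of_mod (t := 0) rfl, loopPoint_of_mod (t := 3 * _) (by omega),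
            loopValue_three_mul x _ le_rfl, List.take_length, hx _ (relator_mem hr)]
          simp [loopValue]
      refine ⟨fun a => roseStep x (loopPoint (relator R r) t) (k a), fun a a' h h' => ?_⟩
      by_cases hlt : 3 * n < a ∧ 3 * n < a'
      · rw [pointStep_of_lt x hlt.1 hlt.2, (key a h).2 hlt.1, (key a' h').2 hlt.2]
        group
      · have e : pointStep x n R a a' = roseStep x (k a) (k a') := by
          simp only [pointStep, k]
          split_ifs <;> first | rfl | omega
        rw [e]
        exact roseStep_of_pair x (key a h).1 (key a' h').1
    · refine ⟨ringValue x n R, fun a a' h h' => ?_⟩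
      have hlt : ∀ a, Incident n R a (3 * n + 2 * Nat.pair r t + 1) → 3 * n < a := by
        intro a h
        obtain rfl | rfl | ⟨s, rfl⟩ := h.of_disc <;> omega
      exact pointStep_of_lt x (hlt a h) (hlt a' h')

/-- The right side does not involve the block, which is exactly triviality on squares. -/
theorem incidenceValue_mul_inv (hR : ∀ w ∈ R, ∀ l ∈ w, l.1 < n)
    (hx : ∀ w ∈ R, wordValue x w = 1) {a a' b : ℕ} (h : Incident n R a b)
    (h' : Incident n R a' b) :
    incidenceValue x n R a b * (incidenceValue x n R a' b)⁻¹ = pointStep x n R a a' := by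
  obtain ⟨F, hF⟩ := exists_potential x hR hx b
  have hp : Incident n R (parentPoint n R b) b := .parent b h.block_lt
  rw [incidenceValue, incidenceValue, hF _ _ h hp, hF _ _ h' hp, hF _ _ h h']
  group

end Values

/-! ### Every voltage trivial on the tree comes from generator values -/

section Universal

variable {n : ℕ} {R : List (List (ℕ × Bool))} {S : Type*} [Group S] {γ : ℕ → ℕ → S}
  {y : ℕ → S}

theorem exists_block_of_roseEdge (hy : ∀ i < n, γ 0 (3 * i + 2) = (y i)⁻¹)
    (hc : ∀ b < numBlocks n R, γ (b + 1) b = 1)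
    (hp : ∀ b < numBlocks n R, γ (parentPoint n R b) b = 1) {u v : ℕ} (h : RoseEdge n u v) :
    ∃ b, Incident n R u b ∧ Incident n R v b ∧
      γ u b * (γ v b)⁻¹ = roseStep y u v := by
  obtain ⟨i, hi, ⟨rfl, rfl⟩ | ⟨rfl, rfl⟩ | ⟨rfl, rfl⟩⟩ := h
  · have hb : 3 * i < numBlocks n R := base_lt_numBlocks (by omega)
    have e : parentPoint n R (3 * i) = 0 := by
      rw [parentPoint, if_pos (by omega), if_pos (by omega)]
    refine ⟨3 * i, e ▸ .parent _ hb, .child _ hb, ?_⟩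
    have := hp _ hb
    rw [e] at this
    simp [this, hc _ hb, roseStep, rosePotential, show (3 * i + 1) % 3 = 1 by omega]
  · have hb : 3 * i + 1 < numBlocks n R := base_lt_numBlocks (by omega)
    have e : parentPoint n R (3 * i + 1) = 3 * i + 1 := by
      rw [parentPoint, if_pos (by omega), if_neg (by omega)]
    have h' := Incident.parent (R := R) _ hb
    have := hp _ hb
    rw [e] at this h'
    refine ⟨3 * i + 1, h', .child _ hb, ?_⟩
    simp [this, hc _ hb, roseStep]
  · have hb : 3 * i + 2 < numBlocks n R := base_lt_numBlocks (by omega)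
    have e : parentPoint n R (3 * i + 2) = 3 * i + 2 := by
      rw [parentPoint, if_pos (by omega), if_neg (by omega)]
    have h' := Incident.parent (R := R) _ hb
    have := hp _ hb
    rw [e] at this h'
    refine ⟨3 * i + 2, h', .base i hi, ?_⟩
    simp [this, hy i hi, roseStep, rosePotential, show (3 * i + 2) % 3 = 2 by omega,
      show (3 * i + 1) / 3 = i by omega]

variable (hR : ∀ w ∈ R, ∀ l ∈ w, l.1 < n) (hy : ∀ i < n, γ 0 (3 * i + 2) = (y i)⁻¹)
  (hsq : ∀ a a' b b', Incident n R a b → Incident n R a' b → Incident n R a b' →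
    Incident n R a' b' → γ a b * (γ a' b)⁻¹ = γ a b' * (γ a' b')⁻¹)
  (hc : ∀ b < numBlocks n R, γ (b + 1) b = 1)
  (hp : ∀ b < numBlocks n R, γ (parentPoint n R b) b = 1)

theorem ring_lt_numBlocks {r t : ℕ} (hr : r < R.length) (ht : t ≤ 3 * (relator R r).length) :
    3 * n + 2 * Nat.pair r t < numBlocks n R :=
  (Nat.lt_succ_self _).trans (disc_lt_numBlocks hr ht)

theorem Incident.loopPoint_ring {r t : ℕ} (hr : r < R.length)
    (ht : t ≤ 3 * (relator R r).length) :
    Incident n R (loopPoint (relator R r) t) (3 * n + 2 * Nat.pair r t) := by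
  simpa using Incident.parent (R := R) _ (ring_lt_numBlocks (n := n) hr ht)

include hp in
theorem apply_loopPoint {r t : ℕ} (hr : r < R.length) (ht : t ≤ 3 * (relator R r).length) :
    γ (loopPoint (relator R r) t) (3 * n + 2 * Nat.pair r t) = 1 := by
  simpa using hp _ (ring_lt_numBlocks hr ht)

-- The pair p_t, p_(t+1) lies both in a rose block and in the ring block, so the known rose value
-- transfers.
include hR hy hsq hc hp in
theorem apply_loop {r t : ℕ} (hr : r < R.length) (ht : t < 3 * (relator R r).length) :
    γ (loopPoint (relator R r) (t + 1)) (3 * n + 2 * Nat.pair r t) =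
      roseStep y (loopPoint (relator R r) (t + 1))
        (loopPoint (relator R r) t) := by
  have h0 : Incident n R (loopPoint (relator R r) t) (3 * n + 2 * Nat.pair r t) :=
    .loopPoint_ring hr ht.le
  have h1 := apply_loopPoint hp hr ht.le
  rcases roseEdge_loopPoint (hR _ (relator_mem hr)) ht with h | h
  · obtain ⟨b, hu, hv, e⟩ := exists_block_of_roseEdge hy hc hp h
    rw [← roseStep_inv, ← e, hsq _ _ _ _ hu hv h0 (.loop r t hr ht), h1]
    simp
  · obtain ⟨b, hu, hv, e⟩ := exists_block_of_roseEdge hy hc hp h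
    rw [← e, hsq _ _ _ _ hu hv (.loop r t hr ht) h0, h1]
    simp

-- The pair q_(t+1), p_(t+1) also lies in the next ring block, where both edges belong to the tree;
-- hence the two points have equal values here.
include hR hy hsq hc hp in
theorem apply_ring {r t : ℕ} (hr : r < R.length) (ht : t < 3 * (relator R r).length) :
    γ (3 * n + 2 * Nat.pair r (t + 1) + 1) (3 * n + 2 * Nat.pair r t) =
      roseStep y (loopPoint (relator R r) (t + 1))
        (loopPoint (relator R r) t) := by
  have hb := ring_lt_numBlocks (n := n) hr (show t + 1 ≤ _ from ht)
  have := hsq _ _ _ _ (.ring r t hr ht) (.loop r t hr ht) (.child _ hb)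
    (.loopPoint_ring hr ht)
  rw [hc _ hb, apply_loopPoint hp hr ht, inv_one, mul_one, mul_inv_eq_one] at this
  rw [this, apply_loop hR hy hsq hc hp hr ht]

-- The disc shares each pair q_t, q_(t+1) with a ring block, so its values accumulate the steps of
-- the relator walk.
include hR hy hsq hc hp in
theorem apply_disc {r t : ℕ} (hr : r < R.length) (ht : t ≤ 3 * (relator R r).length) :
    γ (3 * n + 2 * Nat.pair r t + 1) (3 * n + 2 * Nat.pair r 0 + 1) =
      (loopValue y (relator R r) t)⁻¹ := by
  induction t with
  | zero =>
    have := hp _ (disc_lt_numBlocks hr (Nat.zero_le _))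
    rw [parentPoint_disc] at this
    simp [this, loopValue]
  | succ t ih =>
    have ht' : t < 3 * (relator R r).length := ht
    have hb := ring_lt_numBlocks (n := n) hr ht'.le
    have := hsq _ _ _ _ (.disc r (t + 1) hr ht) (.disc r t hr ht'.le) (.ring r t hr ht')
      (.child _ hb)
    rw [apply_ring hR hy hsq hc hp hr ht', hc _ hb, ih ht'.le, inv_one, mul_one, inv_inv] at this
    rw [eq_mul_inv_of_mul_eq this, loopValue, mul_inv_rev, roseStep_inv]

-- The closing block shares q_0 and the point `0` with the first ring block, which gives the first
-- claim. It shares q_0 and the last ring point with the disc, whose step between them is the whole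
-- relator.
include hR hy hsq hc hp in
theorem apply_close {r : ℕ} (hr : r < R.length) :
    γ (3 * n + 2 * Nat.pair r 0 + 1) (3 * n + 2 * Nat.pair r (3 * (relator R r).length)) = 1 ∧
      loopValue y (relator R r) (3 * (relator R r).length) = 1 := by
  have hb := ring_lt_numBlocks (n := n) hr (Nat.zero_le _)
  have hb' := ring_lt_numBlocks (n := n) hr (le_refl (3 * (relator R r).length))
  have z : loopPoint (relator R r) 0 = 0 := loopPoint_of_mod rfl
  have z' : loopPoint (relator R r) (3 * (relator R r).length) = 0 := loopPoint_of_mod (by omega)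
  have i0 := Incident.loopPoint_ring (n := n) hr (Nat.zero_le _)
  have i1 := Incident.loopPoint_ring (n := n) hr (le_refl (3 * (relator R r).length))
  have v0 := apply_loopPoint hp hr (Nat.zero_le _)
  have v1 := apply_loopPoint hp hr (le_refl (3 * (relator R r).length))
  rw [z] at i0 v0
  rw [z'] at i1 v1
  have h1 := hsq _ _ _ _ (.close r hr) i1 (.child _ hb) i0
  rw [v1, v0, hc _ hb, inv_one, mul_one] at h1
  have h2 := hsq _ _ _ _ (.close r hr) (.child _ hb') (.disc r 0 hr (Nat.zero_le _))
    (.disc r _ hr le_rfl)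
  rw [h1, hc _ hb', apply_disc hR hy hsq hc hp hr (Nat.zero_le _),
    apply_disc hR hy hsq hc hp hr le_rfl] at h2
  simp only [loopValue, inv_one, one_mul, mul_one, inv_inv] at h2
  exact ⟨by simpa using h1, h2.symm⟩

include hR hy hsq hc hp in
theorem wordValue_of_universal {w : List (ℕ × Bool)} (hw : w ∈ R) :
    wordValue y w = 1 := by
  obtain ⟨r, hr, rfl⟩ := List.getElem_of_mem hw
  have h := (apply_close hR hy hsq hc hp hr).2
  rw [loopValue_three_mul _ _ le_rfl, List.take_length] at h
  simpa [relator, hr] using h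

include hR hy hsq hc hp in
theorem apply_eq_incidenceValue {a b : ℕ} (h : Incident n R a b) :
    γ a b = incidenceValue y n R a b := by
  cases h with
  | child b hb => rw [hc b hb, incidenceValue_child _ hR]
  | parent b hb => rw [hp b hb, incidenceValue_parent]
  | base i hi => rw [incidenceValue_base _ hi, hy i hi]
  | ring r t hr ht =>
    rw [apply_ring hR hy hsq hc hp hr ht, incidenceValue, parentPoint_ring,
      pointStep_ring_rose _ _ _ (loopPoint_le hR r t)]
  | loop r t hr ht =>
    rw [apply_loop hR hy hsq hc hp hr ht, incidenceValue, parentPoint_ring,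
      pointStep_rose_rose _ (loopPoint_le hR r _) (loopPoint_le hR r t)]
  | disc r t hr ht =>
    rw [apply_disc hR hy hsq hc hp hr ht, incidenceValue, parentPoint_disc, pointStep_ring_ring]
    simp [loopValue]
  | close r hr =>
    rw [(apply_close hR hy hsq hc hp hr).1, incidenceValue, parentPoint_ring,
      pointStep_ring_rose _ _ _ (loopPoint_le hR r _), loopPoint_of_mod rfl,
      loopPoint_of_mod (by omega), roseStep_self]

end Universal

/-! ### The edge list and its computability -/

/-- The incident pairs of a point and a block. -/
def incidenceList (c : ℕ × List (List (ℕ × Bool))) : List (ℕ × ℕ) :=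
  (List.range (numBlocks c.1 c.2)).flatMap (fun b => [(b + 1, b), (parentPoint c.1 c.2 b, b)]) ++
  ((List.range c.1).map (fun i => (0, 3 * i + 2)) ++
  ((List.range c.2.length).flatMap fun r =>
    (3 * c.1 + 2 * Nat.pair r 0 + 1,
      3 * c.1 + 2 * Nat.pair r (3 * (relator c.2 r).length)) ::
    ((List.range (3 * (relator c.2 r).length)).flatMap (fun t =>
      [(3 * c.1 + 2 * Nat.pair r (t + 1) + 1, 3 * c.1 + 2 * Nat.pair r t),
        (loopPoint (relator c.2 r) (t + 1), 3 * c.1 + 2 * Nat.pair r t)]) ++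
    (List.range (3 * (relator c.2 r).length + 1)).map fun t =>
      (3 * c.1 + 2 * Nat.pair r t + 1, 3 * c.1 + 2 * Nat.pair r 0 + 1))))

theorem mem_incidenceList {c : ℕ × List (List (ℕ × Bool))} {a b : ℕ} :
    (a, b) ∈ incidenceList c ↔ Incident c.1 c.2 a b := by
  simp only [incidenceList, List.mem_append, List.mem_flatMap, List.mem_range, List.mem_map,
    List.mem_cons, Prod.mk.injEq, List.not_mem_nil, or_false]
  constructor
  · rintro (⟨b, hb, ⟨rfl, rfl⟩ | ⟨rfl, rfl⟩⟩ | ⟨i, hi, rfl, rfl⟩ | ⟨r, hr, ⟨rfl, rfl⟩ |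
      ⟨t, ht, ⟨rfl, rfl⟩ | ⟨rfl, rfl⟩⟩ | ⟨t, ht, rfl, rfl⟩⟩)
    · exact .child _ hb
    · exact .parent _ hb
    · exact .base i hi
    · exact .close r hr
    · exact .ring r t hr ht
    · exact .loop r t hr ht
    · exact .disc r t hr (Nat.lt_succ_iff.1 ht)
  · intro h
    cases h with
    | child b hb => exact Or.inl ⟨_, hb, Or.inl ⟨rfl, rfl⟩⟩
    | parent b hb => exact Or.inl ⟨_, hb, Or.inr ⟨rfl, rfl⟩⟩
    | base i hi => exact Or.inr (Or.inl ⟨i, hi, rfl, rfl⟩)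
    | close r hr => exact Or.inr (Or.inr ⟨r, hr, Or.inl ⟨rfl, rfl⟩⟩)
    | ring r t hr ht =>
      exact Or.inr (Or.inr ⟨r, hr, Or.inr (Or.inl ⟨t, ht, Or.inl ⟨rfl, rfl⟩⟩)⟩)
    | loop r t hr ht =>
      exact Or.inr (Or.inr ⟨r, hr, Or.inr (Or.inl ⟨t, ht, Or.inr ⟨rfl, rfl⟩⟩)⟩)
    | disc r t hr ht =>
      exact Or.inr (Or.inr ⟨r, hr, Or.inr (Or.inr ⟨t, Nat.lt_succ_iff.2 ht, rfl, rfl⟩)⟩)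

/-- The code of the graph of a presentation: the point `a` becomes the vertex `2 * a`, and the
block `b` becomes the vertex `2 * b + 1`. -/
def graphCode (c : ℕ × List (List (ℕ × Bool))) : ℕ × List (ℕ × ℕ) :=
  (2 * numBlocks c.1 c.2 + 1, (incidenceList c).flatMap fun e =>
    [(2 * e.1, 2 * e.2 + 1), (2 * e.2 + 1, 2 * e.1)])

section Primrec

variable {α : Type*} [Primcodable α]

theorem primrec_relator : Primrec₂ relator :=
  Primrec.option_getD.comp Primrec.list_getElem? (Primrec.const [])

theorem primrec_loopPoint : Primrec₂ loopPoint := by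
  have hmod : Primrec fun p : List (ℕ × Bool) × ℕ => p.2 % 3 :=
    Primrec.nat_mod.comp Primrec.snd (Primrec.const 3)
  refine Primrec.option_getD.comp (Primrec.option_map
    (Primrec.list_getElem?.comp Primrec.fst (Primrec.nat_div.comp Primrec.snd (Primrec.const 3)))
    ?_) (Primrec.const 0)
  have hm : Primrec fun p : (List (ℕ × Bool) × ℕ) × ℕ × Bool => p.1.2 % 3 :=
    hmod.comp Primrec.fst
  have hi : Primrec fun p : (List (ℕ × Bool) × ℕ) × ℕ × Bool => 3 * p.2.1 :=
    Primrec.nat_mul.comp (Primrec.const 3) (Primrec.fst.comp Primrec.snd)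
  have hs : Primrec fun p : (List (ℕ × Bool) × ℕ) × ℕ × Bool => p.2.2 :=
    Primrec.snd.comp Primrec.snd
  have hd : Primrec fun p : (List (ℕ × Bool) × ℕ) × ℕ × Bool => decide (p.1.2 % 3 = 1) :=
    (Primrec.eq.comp hm (Primrec.const 1)).decide
  exact Primrec.ite (Primrec.eq.comp hm (Primrec.const 0)) (Primrec.const 0)
    (Primrec.ite (Primrec.eq.comp hs hd) (Primrec.nat_add.comp hi (Primrec.const 1))
      (Primrec.nat_add.comp hi (Primrec.const 2)))

/-- The function `3 * n + 2 * c` is primitive recursive in both arguments. -/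
theorem primrec_three_mul_add {f g : α → ℕ} (hf : Primrec f) (hg : Primrec g) :
    Primrec fun x => 3 * f x + 2 * g x :=
  Primrec.nat_add.comp (Primrec.nat_mul.comp (Primrec.const 3) hf)
    (Primrec.nat_mul.comp (Primrec.const 2) hg)

theorem primrec_numBlocks {f : α → ℕ} {g : α → List (List (ℕ × Bool))} (hf : Primrec f)
    (hg : Primrec g) : Primrec fun x => numBlocks (f x) (g x) := by
  have h : Primrec fun x => (g x).length + 3 * (g x).flatten.length + 1 :=
    Primrec.succ.comp (Primrec.nat_add.comp (Primrec.list_length.comp hg)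
      (Primrec.nat_mul.comp (Primrec.const 3)
        (Primrec.list_length.comp (Primrec.list_flatten.comp hg))))
  exact (primrec_three_mul_add hf (Primrec.nat_mul.comp h h)).of_eq fun x => by
    rw [numBlocks, sq]

theorem primrec_parentPoint {f h : α → ℕ} {g : α → List (List (ℕ × Bool))} (hf : Primrec f)
    (hg : Primrec g) (hh : Primrec h) : Primrec fun x => parentPoint (f x) (g x) (h x) := by
  have h3 : Primrec fun x => 3 * f x := Primrec.nat_mul.comp (Primrec.const 3) hf
  have hs : Primrec fun x => h x - 3 * f x := Primrec.nat_sub.comp hh h3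
  have hu : Primrec fun x => ((h x - 3 * f x) / 2).unpair :=
    Primrec.unpair.comp (Primrec.nat_div.comp hs (Primrec.const 2))
  exact Primrec.ite (Primrec.nat_lt.comp hh h3)
    (Primrec.ite (Primrec.eq.comp (Primrec.nat_mod.comp hh (Primrec.const 3)) (Primrec.const 0))
      (Primrec.const 0) hh)
    (Primrec.ite (Primrec.eq.comp (Primrec.nat_mod.comp hs (Primrec.const 2)) (Primrec.const 0))
      (primrec_loopPoint.comp (primrec_relator.comp hg (Primrec.fst.comp hu))
        (Primrec.snd.comp hu)) hh)

theorem primrec_list_pair {β : Type*} [Primcodable β] {f g : α → β} (hf : Primrec f)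
    (hg : Primrec g) : Primrec fun x => [f x, g x] :=
  Primrec.list_cons.comp hf (Primrec.list_cons.comp hg (Primrec.const []))

theorem primrec_incidenceList : Primrec incidenceList := by
  have p {β : Type} [Primcodable β] {f r t : β → ℕ} (hf : Primrec f) (hr : Primrec r)
      (ht : Primrec t) : Primrec fun x => 3 * f x + 2 * Nat.pair (r x) (t x) :=
    primrec_three_mul_add hf (Primrec₂.natPair.comp hr ht)
  refine Primrec.list_append.comp ?_ (Primrec.list_append.comp ?_ ?_)
  · refine Primrec.list_flatMap (Primrec.list_range.comp
      (primrec_numBlocks Primrec.fst Primrec.snd)) ?_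
    exact primrec_list_pair (Primrec.pair (Primrec.succ.comp Primrec.snd) Primrec.snd)
      (Primrec.pair (primrec_parentPoint (Primrec.fst.comp Primrec.fst)
        (Primrec.snd.comp Primrec.fst) Primrec.snd) Primrec.snd)
  · refine Primrec.list_map (Primrec.list_range.comp Primrec.fst) ?_
    exact Primrec.pair (Primrec.const 0) (Primrec.nat_add.comp
      (Primrec.nat_mul.comp (Primrec.const 3) Primrec.snd) (Primrec.const 2))
  · refine Primrec.list_flatMap
      (Primrec.list_range.comp (Primrec.list_length.comp Primrec.snd)) ?_
    have hn : Primrec fun x : (ℕ × List (List (ℕ × Bool))) × ℕ => x.1.1 :=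
      Primrec.fst.comp Primrec.fst
    have hw : Primrec fun x : (ℕ × List (List (ℕ × Bool))) × ℕ => relator x.1.2 x.2 :=
      primrec_relator.comp (Primrec.snd.comp Primrec.fst) Primrec.snd
    have hl : Primrec fun x : (ℕ × List (List (ℕ × Bool))) × ℕ =>
        3 * (relator x.1.2 x.2).length :=
      Primrec.nat_mul.comp (Primrec.const 3) (Primrec.list_length.comp hw)
    have hn' : Primrec fun x : ((ℕ × List (List (ℕ × Bool))) × ℕ) × ℕ => x.1.1.1 :=
      hn.comp Primrec.fst
    have hr' : Primrec fun x : ((ℕ × List (List (ℕ × Bool))) × ℕ) × ℕ => x.1.2 :=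
      Primrec.snd.comp Primrec.fst
    have ht' : Primrec fun x : ((ℕ × List (List (ℕ × Bool))) × ℕ) × ℕ => x.2 + 1 :=
      Primrec.succ.comp Primrec.snd
    refine Primrec.list_cons.comp (Primrec.pair
      (Primrec.succ.comp (p hn Primrec.snd (Primrec.const 0))) (p hn Primrec.snd hl))
      (Primrec.list_append.comp (Primrec.list_flatMap (Primrec.list_range.comp hl) ?_)
        (Primrec.list_map (Primrec.list_range.comp (Primrec.succ.comp hl)) ?_))
    · exact primrec_list_pair
        (Primrec.pair (Primrec.succ.comp (p hn' hr' ht')) (p hn' hr' Primrec.snd))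
        (Primrec.pair (primrec_loopPoint.comp (hw.comp Primrec.fst) ht')
          (p hn' hr' Primrec.snd))
    · exact Primrec.pair (Primrec.succ.comp (p hn' hr' Primrec.snd))
        (Primrec.succ.comp (p hn' hr' (Primrec.const 0)))

theorem primrec_graphCode : Primrec graphCode := by
  have h2 : Primrec fun x : (ℕ × List (List (ℕ × Bool))) × ℕ × ℕ => 2 * x.2.1 :=
    Primrec.nat_mul.comp (Primrec.const 2) (Primrec.fst.comp Primrec.snd)
  have h3 : Primrec fun x : (ℕ × List (List (ℕ × Bool))) × ℕ × ℕ => 2 * x.2.2 + 1 :=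
    Primrec.succ.comp (Primrec.nat_mul.comp (Primrec.const 2) (Primrec.snd.comp Primrec.snd))
  exact Primrec.pair (Primrec.succ.comp (Primrec.nat_mul.comp (Primrec.const 2)
      (primrec_numBlocks Primrec.fst Primrec.snd)))
    (Primrec.list_flatMap primrec_incidenceList
      (primrec_list_pair (Primrec.pair h2 h3) (Primrec.pair h3 h2)))

end Primrec

/-! ### The incidence graph, its spanning tree and its voltages -/

/-- The bipartite graph of points and blocks. -/
def incidenceGraph (n : ℕ) (R : List (List (ℕ × Bool))) :
    SimpleGraph (Fin (2 * numBlocks n R + 1)) where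
  Adj u v := ∃ a b, Incident n R a b ∧
    (u.val = 2 * a ∧ v.val = 2 * b + 1 ∨ u.val = 2 * b + 1 ∧ v.val = 2 * a)
  symm := ⟨by
    rintro u v ⟨a, b, h, h'⟩
    exact ⟨a, b, h, by tauto⟩⟩
  loopless := ⟨by
    rintro u ⟨a, b, -, h'⟩
    omega⟩

variable {n : ℕ} {R : List (List (ℕ × Bool))}

theorem describes_incidenceGraph (hR : ∀ w ∈ R, ∀ l ∈ w, l.1 < n) :
    Describes (graphCode (n, R)) (incidenceGraph n R) := by
  rintro ⟨p, q⟩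
  simp only [graphCode, List.mem_flatMap, List.mem_cons, List.not_mem_nil, or_false,
    Prod.mk.injEq, Prod.exists, mem_incidenceList]
  constructor
  · rintro ⟨a, b, h, h'⟩
    have h1 := h.block_lt
    have h2 := h.point_le hR
    exact ⟨⟨p, by omega⟩, ⟨q, by omega⟩, ⟨a, b, h, h'⟩, rfl, rfl⟩
  · rintro ⟨u, v, ⟨a, b, h, h'⟩, rfl, rfl⟩
    exact ⟨a, b, h, h'⟩

theorem isBipartite_incidenceGraph : (incidenceGraph n R).IsBipartite := by
  refine ⟨SimpleGraph.Coloring.mk (fun u => ⟨u.val % 2, Nat.mod_lt _ two_pos⟩) ?_⟩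
  rintro u v ⟨a, b, -, h⟩ e
  have := congrArg Fin.val e
  simp only at this
  omega

/-- The parent function of a spanning tree of the incidence graph. -/
def incidenceParent (hR : ∀ w ∈ R, ∀ l ∈ w, l.1 < n) (v : Fin (2 * numBlocks n R + 1)) :
    Fin (2 * numBlocks n R + 1) :=
  ⟨if v.val % 2 = 0 then v.val - 1 else 2 * parentPoint n R (v.val / 2), by
    have := parentPoint_le hR (v.val / 2)
    have := v.2
    split_ifs <;> omega⟩

theorem eq_child_or_parent (hR : ∀ w ∈ R, ∀ l ∈ w, l.1 < n)
    {v : Fin (2 * numBlocks n R + 1)} (hv : v ≠ 0) : ∃ b < numBlocks n R,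
      ((incidenceParent hR v).val = 2 * b + 1 ∧ v.val = 2 * (b + 1)) ∨
      ((incidenceParent hR v).val = 2 * parentPoint n R b ∧ v.val = 2 * b + 1) := by
  have hv' : v.val ≠ 0 := fun h => hv (Fin.ext h)
  have := v.2
  unfold incidenceParent
  by_cases h : v.val % 2 = 0
  · exact ⟨v.val / 2 - 1, by omega, Or.inl ⟨by simp only [if_pos h]; omega, by omega⟩⟩
  · exact ⟨v.val / 2, by omega, Or.inr ⟨by simp only [if_neg h], by omega⟩⟩

theorem incidenceParent_spec (hR : ∀ w ∈ R, ∀ l ∈ w, l.1 < n)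
    (v : Fin (2 * numBlocks n R + 1)) (hv : v ≠ 0) :
    (incidenceGraph n R).Adj (incidenceParent hR v) v ∧ (incidenceParent hR v).val < v.val := by
  obtain ⟨b, hb, h⟩ := eq_child_or_parent hR hv
  have := parentPoint_le hR b
  refine ⟨?_, by omega⟩
  rcases h with ⟨h, h'⟩ | ⟨h, h'⟩
  · exact ⟨_, _, .child b hb, Or.inr ⟨h, h'⟩⟩
  · exact ⟨_, _, .parent b hb, Or.inl ⟨h, h'⟩⟩

/-- The voltage assignment on the incidence graph given by values of incident pairs. -/
def incidenceVoltage {H : Type*} [Group H] (f : ℕ → ℕ → H)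
    (u v : Fin (2 * numBlocks n R + 1)) : H :=
  if u.val % 2 = 0 then f (u.val / 2) (v.val / 2) else (f (v.val / 2) (u.val / 2))⁻¹

section Voltage

variable {H : Type*} [Group H] {f : ℕ → ℕ → H} {u v : Fin (2 * numBlocks n R + 1)} {a b : ℕ}

theorem incidenceVoltage_of_even (hu : u.val = 2 * a) (hv : v.val = 2 * b + 1) :
    incidenceVoltage f u v = f a b := by
  rw [incidenceVoltage, if_pos (by omega), show u.val / 2 = a by omega,
    show v.val / 2 = b by omega]

theorem incidenceVoltage_of_odd (hu : u.val = 2 * b + 1) (hv : v.val = 2 * a) :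
    incidenceVoltage f u v = (f a b)⁻¹ := by
  rw [incidenceVoltage, if_neg (by omega), show u.val / 2 = b by omega,
    show v.val / 2 = a by omega]

theorem adj_of_even (h : (incidenceGraph n R).Adj u v) (hu : u.val % 2 = 0) :
    ∃ a b, Incident n R a b ∧ u.val = 2 * a ∧ v.val = 2 * b + 1 := by
  obtain ⟨a, b, hab, h' | h'⟩ := h
  · exact ⟨a, b, hab, h'⟩
  · omega

theorem isVoltage_incidenceVoltage
    (hf : ∀ a a' b b', Incident n R a b → Incident n R a' b → Incident n R a b' →
      Incident n R a' b' → f a b * (f a' b)⁻¹ = f a b' * (f a' b')⁻¹) :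
    IsVoltage (incidenceGraph n R) (incidenceVoltage f) := by
  have heven : ∀ {s₀ s₁ s₂ s₃ : Fin (2 * numBlocks n R + 1)}, s₀.val % 2 = 0 →
      (incidenceGraph n R).Adj s₀ s₁ → (incidenceGraph n R).Adj s₁ s₂ →
      (incidenceGraph n R).Adj s₂ s₃ → (incidenceGraph n R).Adj s₃ s₀ →
      incidenceVoltage f s₀ s₁ * incidenceVoltage f s₁ s₂ * incidenceVoltage f s₂ s₃ *
        incidenceVoltage f s₃ s₀ = 1 := by
    intro s₀ s₁ s₂ s₃ e h₀ h₁ h₂ h₃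
    obtain ⟨a, b, hab, ea, eb⟩ := adj_of_even h₀ e
    obtain ⟨a₁, b₁, hab₁, ea₁, eb₁⟩ := adj_of_even h₃.symm e
    have e₂ : s₂.val % 2 = 0 := by
      obtain ⟨p, q, -, h | h⟩ := h₁ <;> omega
    obtain ⟨a₂, b₂, hab₂, ea₂, eb₂⟩ := adj_of_even h₁.symm e₂
    obtain ⟨a₃, b₃, hab₃, ea₃, eb₃⟩ := adj_of_even h₂ e₂
    obtain rfl : a = a₁ := by omega
    obtain rfl : b = b₂ := by omega
    obtain rfl : a₂ = a₃ := by omega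
    obtain rfl : b₁ = b₃ := by omega
    rw [incidenceVoltage_of_even ea eb, incidenceVoltage_of_odd eb ea₂,
      incidenceVoltage_of_even ea₂ eb₁, incidenceVoltage_of_odd eb₁ ea, hf a a₂ b b₁] <;>
      first | assumption | group
  refine ⟨?_, ?_⟩
  · rintro u v ⟨a, b, -, ⟨hu, hv⟩ | ⟨hu, hv⟩⟩
    · rw [incidenceVoltage_of_even hu hv, incidenceVoltage_of_odd hv hu, mul_inv_cancel]
    · rw [incidenceVoltage_of_odd hu hv, incidenceVoltage_of_even hv hu, inv_mul_cancel]
  · intro s₀ s₁ s₂ s₃ h₀ h₁ h₂ h₃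
    by_cases e : s₀.val % 2 = 0
    · exact heven e h₀ h₁ h₂ h₃
    · have e₁ : s₁.val % 2 = 0 := by
        obtain ⟨p, q, -, h | h⟩ := h₀ <;> omega
      -- A closed walk starting at a block is rotated to start at a point; triviality is invariant
      -- under conjugation.
      have := heven e₁ h₁ h₂ h₃ h₀
      rw [mul_eq_one_comm] at this
      simpa only [mul_assoc] using this

end Voltage

/-- All the values are built from the generator values by group operations, hence are natural in the
group. -/
theorem map_incidenceValue {H K : Type*} [Group H] [Group K] (ψ : H →* K) (x : ℕ → H)
    (a b : ℕ) :
    ψ (incidenceValue x n R a b) = incidenceValue (fun i => ψ (x i)) n R a b := by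
  have h1 : ∀ u, ψ (rosePotential x u) = rosePotential (fun i => ψ (x i)) u := by
    intro u
    unfold rosePotential
    split_ifs <;> simp
  have h2 : ∀ u v, ψ (roseStep x u v) = roseStep (fun i => ψ (x i)) u v := by
    intro u v
    unfold roseStep
    split_ifs <;> simp [h1]
  have h3 : ∀ w t, ψ (loopValue x w t) = loopValue (fun i => ψ (x i)) w t := by
    intro w t
    induction t with
    | zero => simp [loopValue]
    | succ t ih => simp [loopValue, ih, h2]
  unfold incidenceValue pointStep ringValue
  split_ifs <;> simp [h2, h3]

/-- The square group of the incidence graph has the universal property of the group presented by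
the relators. -/
theorem squareGroup_incidenceGraph (hR : ∀ w ∈ R, ∀ l ∈ w, l.1 < n) {P : Type} [Group P]
    (x : ℕ → P) (hx : ∀ w ∈ R, wordValue x w = 1)
    (hgen : Subgroup.closure {g | ∃ i < n, x i = g} = ⊤)
    (hinit : ∀ (S : Type) [Group S] (y : ℕ → S), (∀ i, n ≤ i → y i = 1) →
      (∀ w ∈ R, wordValue y w = 1) → ∃ ψ : P →* S, ∀ i, ψ (x i) = y i)
    (a : Fin (2 * numBlocks n R + 1)) :
    Nonempty (SquareGroup (incidenceGraph n R) a ≃* P) := by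
  refine nonempty_squareGroup_mulEquiv (fun v => v.val) (incidenceParent_spec hR)
    (l := incidenceVoltage (incidenceValue x n R)) (isVoltage_incidenceVoltage ?_) ?_ ?_ ?_ a
  · intro a a' b b' h₁ h₂ h₃ h₄
    rw [incidenceValue_mul_inv x hR hx h₁ h₂, incidenceValue_mul_inv x hR hx h₃ h₄]
  · intro v hv
    obtain ⟨b, hb, ⟨h, h'⟩ | ⟨h, h'⟩⟩ := eq_child_or_parent hR hv
    · rw [incidenceVoltage_of_odd h h', incidenceValue_child x hR, inv_one]
    · rw [incidenceVoltage_of_even h h', incidenceValue_parent]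
  · rw [eq_top_iff, ← hgen]
    refine Subgroup.closure_mono ?_
    rintro _ ⟨i, hi, rfl⟩
    have hb : 3 * i + 2 < numBlocks n R := base_lt_numBlocks (by omega)
    -- The non-tree edge from the block `3 * i + 2` to the point `0` carries the generator `x i`.
    refine ⟨⟨2 * (3 * i + 2) + 1, by omega⟩, ⟨2 * 0, by omega⟩,
      ⟨0, 3 * i + 2, .base i hi, Or.inr ⟨rfl, rfl⟩⟩, ?_⟩
    rw [incidenceVoltage_of_odd rfl rfl, incidenceValue_base x hi, inv_inv]
  · intro S _ g hg hgT
    let γ : ℕ → ℕ → S := fun a b =>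
      if h : a ≤ numBlocks n R ∧ b < numBlocks n R then
        g ⟨2 * a, by omega⟩ ⟨2 * b + 1, by omega⟩ else 1
    have hγ : ∀ {u v : Fin (2 * numBlocks n R + 1)} {a b : ℕ}, u.val = 2 * a →
        v.val = 2 * b + 1 → γ a b = g u v := by
      rintro ⟨u, hu⟩ ⟨v, hv⟩ a b rfl rfl
      exact dif_pos ⟨by omega, by omega⟩
    have hadj : ∀ {a b : ℕ}, Incident n R a b → ∃ u v : Fin (2 * numBlocks n R + 1),
        (incidenceGraph n R).Adj u v ∧ u.val = 2 * a ∧ v.val = 2 * b + 1 := by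
      intro a b h
      have h1 := h.point_le hR
      have h2 := h.block_lt
      exact ⟨⟨2 * a, by omega⟩, ⟨2 * b + 1, by omega⟩, ⟨a, b, h, Or.inl ⟨rfl, rfl⟩⟩, rfl, rfl⟩
    have hsymm : ∀ {u v}, (incidenceGraph n R).Adj u v → g v u = (g u v)⁻¹ :=
      fun h => eq_inv_of_mul_eq_one_right (hg.symm h)
    have hsq : ∀ a a' b b', Incident n R a b → Incident n R a' b → Incident n R a b' →
        Incident n R a' b' → γ a b * (γ a' b)⁻¹ = γ a b' * (γ a' b')⁻¹ := by
      intro a a' b b' h₁ h₂ h₃ h₄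
      obtain ⟨u, v, k₁, eu, ev⟩ := hadj h₁
      obtain ⟨u', v', k₄, eu', ev'⟩ := hadj h₄
      have k₂ : (incidenceGraph n R).Adj u' v := ⟨a', b, h₂, Or.inl ⟨eu', ev⟩⟩
      have k₃ : (incidenceGraph n R).Adj u v' := ⟨a, b', h₃, Or.inl ⟨eu, ev'⟩⟩
      rw [hγ eu ev, hγ eu' ev, hγ eu ev', hγ eu' ev']
      have := hg.square k₁ k₂.symm k₄ k₃.symm
      rw [hsymm k₂, hsymm k₃, mul_inv_eq_one] at this
      rw [← this, mul_inv_cancel_right]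
    have htree : ∀ b < numBlocks n R, γ (b + 1) b = 1 ∧ γ (parentPoint n R b) b = 1 := by
      intro b hb
      constructor
      · have hv := hgT ⟨2 * (b + 1), by omega⟩ (by simp [Fin.ext_iff])
        have hs := (incidenceParent_spec hR ⟨2 * (b + 1), by omega⟩ (by simp [Fin.ext_iff])).1
        rw [hγ (u := ⟨2 * (b + 1), by omega⟩) rfl (v := incidenceParent hR _), hsymm hs, hv,
          inv_one]
        simp [incidenceParent]
        omega
      · have hv := hgT ⟨2 * b + 1, by omega⟩ (by simp [Fin.ext_iff])
        rw [← hv]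
        refine hγ ?_ rfl
        rw [incidenceParent]
        simp only
        rw [if_neg (by omega), show (2 * b + 1) / 2 = b by omega]
    -- Indices from `n` on are not generators; the value 1 there is what `hinit` requires.
    let y : ℕ → S := fun i => if i < n then (γ 0 (3 * i + 2))⁻¹ else 1
    have hy : ∀ i < n, γ 0 (3 * i + 2) = (y i)⁻¹ := fun i hi => by simp [y, hi]
    have hc := fun b hb => (htree b hb).1
    have hp := fun b hb => (htree b hb).2
    obtain ⟨ψ, hψ⟩ := hinit S y (fun i hi => if_neg (not_lt.2 hi))
      (fun w hw => wordValue_of_universal hR hy hsq hc hp hw)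
    have hval : ∀ {a b : ℕ}, Incident n R a b → ψ (incidenceValue x n R a b) = γ a b := by
      intro a b h
      rw [map_incidenceValue, apply_eq_incidenceValue hR hy hsq hc hp h]
      simp only [hψ]
    refine ⟨ψ, ?_⟩
    rintro u v ⟨a, b, h, ⟨hu, hv⟩ | ⟨hu, hv⟩⟩
    · rw [incidenceVoltage_of_even hu hv, hval h, hγ hu hv]
    · have hvu : (incidenceGraph n R).Adj v u := ⟨a, b, h, Or.inl ⟨hv, hu⟩⟩
      rw [incidenceVoltage_of_odd hu hv, map_inv, hval h, hγ hv hu, hsymm hvu]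

/-! ### Application to the presented group -/

theorem lift_mk_eq_wordValue {n : ℕ} {H : Type*} [Group H] (y : ℕ → H)
    (w : List (Fin n × Bool)) :
    FreeGroup.lift (fun i : Fin n => y i.val) (FreeGroup.mk w) =
      wordValue y (w.map fun l => (l.1.val, l.2)) := by
  rw [FreeGroup.lift_mk, wordValue, List.map_map]
  congr 1
  refine List.map_congr_left fun l _ => ?_
  obtain ⟨i, s⟩ := l
  cases s <;> rfl

end GraphSquare

/-- There is an algorithm which, from any finite presentation `⟨E : R⟩`, constructs a finite
connected bipartite graph whose square group, at any base vertex, is isomorphic to `⟨E : R⟩`. -/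
theorem mainTheorem3 :
    ∃ f : ℕ × List (List (ℕ × Bool)) → ℕ × List (ℕ × ℕ), Computable f ∧
      ∀ (n : ℕ) (R : List (List (Fin n × Bool))),
        ∃ G : SimpleGraph (Fin (f (GraphSquare.presentationCode n R)).1),
          GraphSquare.Describes (f (GraphSquare.presentationCode n R)) G ∧
          G.Connected ∧ G.IsBipartite ∧
          ∀ a, Nonempty
            (GraphSquare.SquareGroup G a ≃* GraphSquare.GroupOfPresentation n R) := by
  refine ⟨GraphSquare.graphCode, GraphSquare.primrec_graphCode.to_comp, fun n R => ?_⟩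
  have hR : ∀ w ∈ R.map (fun w => w.map fun l : Fin n × Bool => (l.1.val, l.2)),
      ∀ l ∈ w, l.1 < n := by
    simp only [List.mem_map]
    rintro _ ⟨w, -, rfl⟩ l hl
    obtain ⟨l, -, rfl⟩ := List.mem_map.1 hl
    exact l.1.2
  refine ⟨GraphSquare.incidenceGraph n _, GraphSquare.describes_incidenceGraph hR,
    GraphSquare.connected_of_parent _ (GraphSquare.incidenceParent_spec hR),
    GraphSquare.isBipartite_incidenceGraph, ?_⟩
  let x : ℕ → GraphSquare.GroupOfPresentation n R := fun i =>
    if h : i < n then PresentedGroup.of ⟨i, h⟩ else 1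
  have hxi : ∀ i : Fin n, x i = PresentedGroup.of i := fun i => dif_pos i.2
  refine GraphSquare.squareGroup_incidenceGraph hR x ?_ ?_ ?_
  · intro w' hw'
    obtain ⟨w, hw, rfl⟩ := List.mem_map.1 hw'
    rw [← GraphSquare.lift_mk_eq_wordValue]
    have e : FreeGroup.lift (fun i : Fin n => x i.val) =
        PresentedGroup.mk {r : FreeGroup (Fin n) | ∃ w ∈ R, FreeGroup.mk w = r} :=
      FreeGroup.ext_hom _ _ fun i => by rw [FreeGroup.lift_apply_of, hxi]; rfl
    rw [e]
    exact PresentedGroup.one_of_mem ⟨w, hw, rfl⟩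
  · rw [eq_top_iff, ← PresentedGroup.closure_range_of]
    refine Subgroup.closure_mono ?_
    rintro _ ⟨i, rfl⟩
    exact ⟨i, i.2, hxi i⟩
  · intro S _ y hy hw
    have h : ∀ r ∈ {r : FreeGroup (Fin n) | ∃ w ∈ R, FreeGroup.mk w = r},
        FreeGroup.lift (fun i : Fin n => y i.val) r = 1 := by
      rintro _ ⟨w, hwR, rfl⟩
      rw [GraphSquare.lift_mk_eq_wordValue]
      exact hw _ (List.mem_map_of_mem hwR)
    refine ⟨PresentedGroup.toGroup h, fun i => ?_⟩
    by_cases hi : i < n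
    · rw [hxi ⟨i, hi⟩, PresentedGroup.toGroup.of]
    · simp only [x, dif_neg hi, map_one, hy i (not_lt.1 hi)]
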